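/- Let $H:\mathbb R^2\to\,]0,1[$ be a Borel function, homogeneous of degree zero ($H(\lambda\xi)=H(\xi)$ for all $\lambda\in\mathbb R\setminus\{0\}$), let $\underline H=\operatorname{ess\,inf}H$, and write $H(\theta)=H(\cos\theta,\sin\theta)$, a $\pi$-periodic function on $\mathbb R$. Let $A^{(H)}$ be the anisotropic fractional Brownian motion $$A^{(H)}(u)=\int_{\mathbb R^2}\frac{e^{i\langle u,\xi\rangle}-1}{|\xi|^{H(\xi)+1}}\,dW(\xi),\qquad u\in\mathbb R^2,$$ where $W$ is a Hermitian complex Gaussian random measure with Lebesgue control measure, that is, a centered, jointly Gaussian family indexed by the Borel sets of finite measure with $W(-B)=\overline{W(B)}$ a.s. and $\mathbb E[W(B)\overline{W(C)}]=\mathrm{Leb}(B\cap C)$. Let $L>0$, $\varepsilon\ge 0$, $\omega\in[0,2\pi[$, put $$Z_t=A^{(H)}\big(L(t+\varepsilon)\cos\omega,\;L(t+\varepsilon)\sin\omega\big),\quad t\in[0,1],\qquad V_n(Z)=\sum_{k=1}^{n-1}\big[Z_{(k+1)/n}+Z_{(k-1)/n}-2Z_{k/n}\big]^2,$$ and $$\Lambda(\theta)=\frac{C(1,H(\theta))^2}{8}\,L^{2H(\theta)}\,|\cos(\theta-\omega)|^{2H(\theta)},\qquad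 C(1,h)^2=\frac{\pi}{h\,\Gamma(2h)\,\sin(\pi h)}.$$ Assume that $\theta\mapsto H(\theta)$ is of class $C^2$ on $\mathbb R$, that there is a unique $\theta_*\in[0,\pi[$ with $H(\theta_*)=\underline H=\inf_\theta H(\theta)$, that $H''(\theta_*)>0$, and that $\omega\ne\theta_*+\pi/2\pmod\pi$. Then, almost surely, $$\lim_{n\to\infty}n^{2\underline H-1}\sqrt{\log n}\;V_n(Z)=(4-2^{2\underline H})\,G_{\theta_*},\qquad G_{\theta_*}=8\,\Lambda(\theta_*)\sqrt{\frac{\pi}{H''(\theta_*)}}.$$ -/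

import Mathlib

open MeasureTheory ProbabilityTheory Filter Topology
open scoped ENNReal ComplexConjugate

noncomputable section

namespace AFBM

/-- A Hermitian complex Gaussian random measure on `ℝ^d` with Lebesgue control measure:
a centered, jointly Gaussian family of complex random variables `W B`, indexed by the Borel
sets `B` of finite Lebesgue measure, with `W (-B) = conj (W B)` and
`E[W B * conj (W C)] = Leb (B ∩ C)`. (Finite additivity, and countable additivity in `L²`,
hold almost surely as a consequence of the covariance.) Values of `W` on
other sets are irrelevant. -/
structure IsHermitianGaussianMeasure {Ω : Type*} [MeasurableSpace Ω] (P : Measure Ω) {d : ℕ}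
    (W : Set (EuclideanSpace ℝ (Fin d)) → Ω → ℂ) : Prop where
  gaussian : IsGaussianProcess
    (fun B : {B : Set (EuclideanSpace ℝ (Fin d)) // MeasurableSet B ∧ volume B < ∞} =>
      W B.1) P
  centered : ∀ B, MeasurableSet B → volume B < ∞ → ∫ x, W B x ∂P = 0
  hermitian : ∀ B, MeasurableSet B → volume B < ∞ →
    ∀ᵐ x ∂P, W ((fun ξ => -ξ) ⁻¹' B) x = conj (W B x)
  covariance : ∀ B C, MeasurableSet B → volume B < ∞ → MeasurableSet C → volume C < ∞ →
    ∫ x, W B x * conj (W C x) ∂P = ((volume (B ∩ C)).toReal : ℂ)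

/-- The integral `∑ c * W (f = c)` of a simple function (with value `0` off a set of finite
measure) against the random measure `W`. -/
def simpleIntegral {Ω : Type*} {d : ℕ} (W : Set (EuclideanSpace ℝ (Fin d)) → Ω → ℂ)
    (f : SimpleFunc (EuclideanSpace ℝ (Fin d)) ℂ) (x : Ω) : ℂ :=
  ∑ c ∈ f.range, c * W (f ⁻¹' {c}) x

/-- `X` is (a version of) the stochastic integral `∫ f dW`: it is the `L²(P)`-limit of integrals
of square integrable simple functions that converge to `f` in `L²(Leb)`. -/
def IsStochasticIntegral {Ω : Type*} [MeasurableSpace Ω] (P : Measure Ω) {d : ℕ}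
    (W : Set (EuclideanSpace ℝ (Fin d)) → Ω → ℂ) (f : EuclideanSpace ℝ (Fin d) → ℂ)
    (X : Ω → ℂ) : Prop :=
  AEStronglyMeasurable X P ∧
    ∀ η : ℝ≥0∞, 0 < η → ∃ s : SimpleFunc (EuclideanSpace ℝ (Fin d)) ℂ,
      MemLp s 2 volume ∧
      eLpNorm (fun ξ => f ξ - s ξ) 2 volume ≤ η ∧
      eLpNorm (fun x => X x - simpleIntegral W s x) 2 P ≤ η

/-- Directional Hurst index: a Borel function `H : ℝ^d → ]0,1[`, homogeneous of degree zero. -/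
structure IsDirectionalHurst {d : ℕ} (H : EuclideanSpace ℝ (Fin d) → ℝ) : Prop where
  measurable : Measurable H
  mem_Ioo : ∀ ξ, H ξ ∈ Set.Ioo (0 : ℝ) 1
  homogeneous : ∀ (ξ : EuclideanSpace ℝ (Fin d)) (c : ℝ), c ≠ 0 → H (c • ξ) = H ξ

/-- The lower index: the essential infimum of `H`. -/
def lowerHurst {d : ℕ} (H : EuclideanSpace ℝ (Fin d) → ℝ) : ℝ := essInf H volume

/-- The harmonizable kernel `ξ ↦ (exp(i⟨u,ξ⟩) - 1) / |ξ|^(H(ξ) + d/2)`. -/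
def kernel {d : ℕ} (H : EuclideanSpace ℝ (Fin d) → ℝ) (u ξ : EuclideanSpace ℝ (Fin d)) : ℂ :=
  (Complex.exp (Complex.I * ((inner ℝ u ξ : ℝ) : ℂ)) - 1) /
    ((‖ξ‖ ^ (H ξ + (d : ℝ) / 2) : ℝ) : ℂ)

/-- `A` is the (real) anisotropic fractional Brownian motion with directional Hurst index `H`
driven by the random measure `W`: `A u = ∫ kernel H u dW` for every `u`. -/
def IsAFBM {Ω : Type*} [MeasurableSpace Ω] (P : Measure Ω) {d : ℕ}
    (W : Set (EuclideanSpace ℝ (Fin d)) → Ω → ℂ) (H : EuclideanSpace ℝ (Fin d) → ℝ)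
    (A : EuclideanSpace ℝ (Fin d) → Ω → ℝ) : Prop :=
  IsHermitianGaussianMeasure P W ∧
    ∀ u, IsStochasticIntegral P W (kernel H u) (fun x => (A u x : ℂ))

/-- In dimension two, `H` as a function of the angle. -/
def angular (H : EuclideanSpace ℝ (Fin 2) → ℝ) (θ : ℝ) : ℝ :=
  H !₂[Real.cos θ, Real.sin θ]

/-- The restriction of the field `A` to the radial segment with angle `ω`, length `L` and distance
`L * ε` to the origin, parametrized by `t ∈ [0,1]`. -/
def radial {Ω : Type*} (A : EuclideanSpace ℝ (Fin 2) → Ω → ℝ) (L ε ω : ℝ) (t : ℝ) (x : Ω) : ℝ :=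
  A !₂[L * (t + ε) * Real.cos ω, L * (t + ε) * Real.sin ω] x

/-- Second-order quadratic variation
`V_n(X) = ∑_{k=1}^{n-1} (X_{(k+1)/n} + X_{(k-1)/n} - 2 X_{k/n})²`. -/
def quadVar {Ω : Type*} (X : ℝ → Ω → ℝ) (n : ℕ) (x : Ω) : ℝ :=
  ∑ k ∈ Finset.Ico 1 n,
    (X (((k : ℝ) + 1) / n) x + X (((k : ℝ) - 1) / n) x - 2 * X ((k : ℝ) / n) x) ^ 2

/-- The constant
`C(d,H) = (π^((d+1)/2) Γ(H+1/2) / (H Γ(2H) sin(Hπ) Γ(H+d/2)))^(1/2)`. -/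
def hurstConst (d : ℕ) (H : ℝ) : ℝ :=
  Real.sqrt ((Real.pi ^ (((d : ℝ) + 1) / 2) * Real.Gamma (H + 1 / 2)) /
    (H * Real.Gamma (2 * H) * Real.sin (H * Real.pi) * Real.Gamma (H + (d : ℝ) / 2)))

/-- `Λ(θ) = C(1,H(θ))² / 8 * L^(2H(θ)) * |cos(θ-ω)|^(2H(θ))`. -/
def spectralWeight (H : EuclideanSpace ℝ (Fin 2) → ℝ) (L ω θ : ℝ) : ℝ :=
  hurstConst 1 (angular H θ) ^ 2 / 8 * L ^ (2 * angular H θ) *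
    |Real.cos (θ - ω)| ^ (2 * angular H θ)

/-- `G_θ = 8 Λ(θ) √(π / H''(θ))`. -/
def limitConst (H : EuclideanSpace ℝ (Fin 2) → ℝ) (L ω θ : ℝ) : ℝ :=
  8 * spectralWeight H L ω θ * Real.sqrt (Real.pi / iteratedDeriv 2 (angular H) θ)

end AFBM

end

/-! The isometry property of the stochastic integral reduces everything to covariances. In polar
coordinates the variogram of `Z` is `8 ∫ Λ(θ) |t - s|^(2H(θ)) dθ` over any period of length π
(`lintegral_enorm_kernel_sub_sq`), so each second-order increment of mesh `1/n` has variance `σ n =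
∫ 8 Λ (4 - 2^(2H)) n^(-2H) dθ`. Since `n^(-2H) = exp(-2 H log n)`, Laplace's method with large
parameter `log n` concentrates this integral at the minimum of `H`; this produces the factor `√(log
n)`, the second derivative in the limit, and the convergence of the normalized mean
(`tendsto_rpow_mul_integral_rpow`).

It remains to show that `V_n` is almost surely close to its mean `(n - 1) σ n`. The increments form
a Gaussian vector whose covariances are integrals of fourth differences of `|x|^(2H)` against `Λ
n^(-2H)`. These decay at least like `1/(1 + |k - l|)`, uniformly in `H`, which is square summable;
hence the Hilbert-Schmidt norm of the covariance matrix is `O(√n v n)`, where `v n` has the same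
order as `σ n`. The exponential inequality `measure_abs_sum_sq_sub_integral_ge_le` then bounds the
probability of a deviation `n^(3/4) v n` by a constant times `exp(-c n^(1/4))`, and Borel-Cantelli
concludes. -/

/-! ### Exponential concentration of Gaussian quadratic forms. -/

theorem inv_sqrt_one_sub_le_exp {x : ℝ} (hx : |x| ≤ 1 / 2) :
    (√(1 - x))⁻¹ ≤ Real.exp (x / 2 + x ^ 2) := by
  have h1 : 0 < 1 - x := by linarith [abs_le.1 hx]
  have h2 := Real.abs_log_sub_add_sum_range_le (x := x) (by linarith) 1
  have h3 : |x| ^ 2 / (1 - |x|) ≤ 2 * x ^ 2 := by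
    rw [div_le_iff₀ (by linarith), sq_abs]
    nlinarith [sq_nonneg x]
  simp only [Finset.range_one, Finset.sum_singleton, zero_add, pow_one, Nat.cast_zero,
    div_one, one_add_one_eq_two] at h2
  have h4 := (abs_le.1 (h2.trans h3)).1
  rw [Real.sqrt_eq_rpow, ← Real.rpow_neg h1.le, Real.rpow_def_of_pos h1]
  apply Real.exp_le_exp.2
  linarith

/-- The exact value of the integral is `(1 - 2sv)^(-1/2)`. The bound keeps the linear term `s * v`
exact, because centering the square cancels it and leaves a purely quadratic exponent. -/
theorem integrable_exp_mul_sq_gaussianReal {v : NNReal} {s : ℝ} (hs : |s| * v ≤ 1 / 4) :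
    Integrable (fun x => Real.exp (s * x ^ 2)) (gaussianReal 0 v) ∧
      ∫ x, Real.exp (s * x ^ 2) ∂(gaussianReal 0 v) ≤ Real.exp (s * v + 4 * (s * v) ^ 2) := by
  rcases eq_or_ne v 0 with rfl | hv
  · simpa using integrable_dirac (by simp)
  have hv0 : (0 : ℝ) < v := by positivity
  have hsv : |s * v| ≤ 1 / 4 := by rwa [abs_mul, abs_of_pos hv0]
  have hb : 0 < (1 - 2 * (s * v)) / (2 * v) := by
    have := (abs_le.1 hsv).2
    apply div_pos <;> linarith
  have key : ∀ x : ℝ, gaussianPDFReal 0 v x * Real.exp (s * x ^ 2) =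
      (√(2 * Real.pi * v))⁻¹ * Real.exp (-((1 - 2 * (s * v)) / (2 * v)) * x ^ 2) := by
    intro x
    rw [gaussianPDFReal, mul_assoc, ← Real.exp_add]
    congr 2
    field_simp
    ring
  constructor
  · rw [gaussianReal_of_var_ne_zero _ hv, integrable_withDensity_iff_integrable_smul'
      (measurable_gaussianPDF _ _) (by simp [gaussianPDF])]
    simp only [toReal_gaussianPDF, smul_eq_mul, key]
    exact (integrable_exp_neg_mul_sq hb).const_mul _
  · rw [integral_gaussianReal_eq_integral_smul hv]
    simp only [smul_eq_mul, key]
    rw [integral_const_mul, integral_gaussian]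
    have h1 : (√(2 * Real.pi * v))⁻¹ * √(Real.pi / ((1 - 2 * (s * v)) / (2 * v))) =
        (√(1 - 2 * (s * v)))⁻¹ := by
      have : Real.pi / ((1 - 2 * (s * v)) / (2 * v)) = (2 * Real.pi * v) / (1 - 2 * (s * v)) := by
        rw [div_div_eq_mul_div]; congr 1; ring
      rw [this, Real.sqrt_div (by positivity), div_eq_mul_inv, inv_mul_cancel_left₀]
      positivity
    rw [h1]
    refine (inv_sqrt_one_sub_le_exp ?_).trans (le_of_eq ?_)
    · rw [abs_mul, abs_of_pos (by norm_num : (0 : ℝ) < 2)]; linarith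
    · congr 1; ring

theorem mgf_sq_sub_variance_le {Ω : Type*} [MeasurableSpace Ω] {P : Measure Ω} {Y : Ω → ℝ}
    (hY : HasGaussianLaw Y P) (hY0 : ∫ x, Y x ∂P = 0) {s : ℝ} (hs : |s| * Var[Y; P] ≤ 1 / 4) :
    Integrable (fun x => Real.exp (s * (Y x ^ 2 - Var[Y; P]))) P ∧
      mgf (fun x => Y x ^ 2 - Var[Y; P]) P s ≤ Real.exp (4 * s ^ 2 * Var[Y; P] ^ 2) := by
  have hmap := hY.map_eq_gaussianReal
  rw [hY0] at hmap
  have hv : ((Var[Y; P].toNNReal : NNReal) : ℝ) = Var[Y; P] :=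
    Real.coe_toNNReal _ (variance_nonneg _ _)
  obtain ⟨h1, h2⟩ := integrable_exp_mul_sq_gaussianReal (v := Var[Y; P].toNNReal) (s := s)
    (by rwa [hv])
  rw [← hmap] at h1 h2
  have hmeas : AEStronglyMeasurable (fun x => Real.exp (s * x ^ 2)) (P.map Y) :=
    (by fun_prop : Continuous fun x : ℝ => Real.exp (s * x ^ 2)).aestronglyMeasurable
  rw [integrable_map_measure hmeas hY.aemeasurable] at h1
  rw [integral_map hY.aemeasurable hmeas, hv] at h2
  have key : ∀ x, Real.exp (s * (Y x ^ 2 - Var[Y; P])) =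
      Real.exp (-(s * Var[Y; P])) * Real.exp (s * Y x ^ 2) := by
    intro x; rw [← Real.exp_add]; congr 1; ring
  constructor
  · simp only [key]
    exact h1.const_mul _
  · simp only [mgf, key, integral_const_mul]
    refine (mul_le_mul_of_nonneg_left h2 (Real.exp_pos _).le).trans (le_of_eq ?_)
    rw [← Real.exp_add]
    congr 1; ring

/-- Independence and integrability both pass to measurable modifications, and finitely many almost
sure equalities hold simultaneously. -/
theorem ProbabilityTheory.iIndepFun.integrable_exp_mul_sum_of_aemeasurable {Ω ι : Type*}
    [MeasurableSpace Ω] {P : Measure Ω} [IsFiniteMeasure P] {t : ℝ} {X : ι → Ω → ℝ}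
    (hind : iIndepFun X P) (hX : ∀ i, AEMeasurable (X i) P) {s : Finset ι}
    (h : ∀ i ∈ s, Integrable (fun x => Real.exp (t * X i x)) P) :
    Integrable (fun x => Real.exp (t * (∑ i ∈ s, X i) x)) P := by
  have hind' := hind.congr fun i => (hX i).ae_eq_mk
  have := hind'.integrable_exp_mul_sum (t := t) (s := s) (fun i => (hX i).measurable_mk)
    fun i hi => (h i hi).congr ((hX i).ae_eq_mk.mono fun x hx => by simp only [hx])
  refine this.congr ?_
  have hall : ∀ᵐ x ∂P, ∀ i ∈ s, X i x = (hX i).mk _ x :=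
    (Finset.eventually_all s).2 fun i _ => (hX i).ae_eq_mk
  filter_upwards [hall] with x hx
  simp only [Finset.sum_apply]
  rw [Finset.sum_congr rfl hx]

/-- Exponential concentration of a sum of squares of independent centered Gaussian variables. -/
theorem measure_abs_sum_sq_sub_variance_ge_le {Ω : Type*} [MeasurableSpace Ω] {P : Measure Ω}
    [IsProbabilityMeasure P] {ι : Type*} [Fintype ι] {Y : ι → Ω → ℝ}
    (hY : ∀ i, HasGaussianLaw (Y i) P) (hY0 : ∀ i, ∫ x, Y i x ∂P = 0) (hind : iIndepFun Y P)
    {F : ℝ} (hF : 0 < F) (hFY : ∑ i, Var[Y i; P] ^ 2 ≤ F ^ 2) (t : ℝ) :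
    P.real {x | t ≤ |∑ i, (Y i x ^ 2 - Var[Y i; P])|} ≤ 2 * Real.exp (1 / 4 - t / (4 * F)) := by
  have hvar : ∀ i, Var[Y i; P] ≤ F := fun i => by
    refine abs_le_of_sq_le_sq' ?_ hF.le |>.2
    exact (Finset.single_le_sum (f := fun i => Var[Y i; P] ^ 2) (fun _ _ => sq_nonneg _)
      (Finset.mem_univ i)).trans hFY
  have hind' : iIndepFun (fun i x => Y i x ^ 2 - Var[Y i; P]) P :=
    hind.comp₀ (fun i y => y ^ 2 - Var[Y i; P]) (fun i => (hY i).aemeasurable)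
      (fun i => (by fun_prop : Measurable fun y : ℝ => y ^ 2 - Var[Y i; P]).aemeasurable)
  have hm : ∀ i, AEMeasurable (fun x => Y i x ^ 2 - Var[Y i; P]) P := fun i => by
    have := (hY i).aemeasurable
    fun_prop
  -- Chernoff's bound is used at `s = ±1/(4F)`: this is admissible because every variance is at most
  -- `F`, and it makes the total exponent `4 s² F²` equal to `1/4`.
  have hS : ∀ s : ℝ, |s| = 1 / (4 * F) →
      Integrable (fun x => Real.exp (s * ∑ i, (Y i x ^ 2 - Var[Y i; P]))) P ∧
      mgf (fun x => ∑ i, (Y i x ^ 2 - Var[Y i; P])) P s ≤ Real.exp (1 / 4) := by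
    intro s hs
    have hsv : ∀ i, |s| * Var[Y i; P] ≤ 1 / 4 := fun i => by
      rw [hs, div_mul_eq_mul_div, one_mul, div_le_iff₀ (by positivity)]
      linarith [hvar i]
    constructor
    · have := hind'.integrable_exp_mul_sum_of_aemeasurable (t := s) (s := Finset.univ) hm
        (fun i _ => (mgf_sq_sub_variance_le (hY i) (hY0 i) (hsv i)).1)
      simpa only [Finset.sum_apply] using this
    · have := hind'.mgf_sum₀ (t := s) hm Finset.univ
      have h2 : (∑ i, fun x => Y i x ^ 2 - Var[Y i; P]) =
          fun x => ∑ i, (Y i x ^ 2 - Var[Y i; P]) := by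
        ext x; simp
      rw [h2] at this
      rw [this]
      calc ∏ i, mgf (fun x => Y i x ^ 2 - Var[Y i; P]) P s
          ≤ ∏ i, Real.exp (4 * s ^ 2 * Var[Y i; P] ^ 2) :=
            Finset.prod_le_prod (fun i _ => mgf_nonneg) fun i _ =>
              (mgf_sq_sub_variance_le (hY i) (hY0 i) (hsv i)).2
        _ = Real.exp (4 * s ^ 2 * ∑ i, Var[Y i; P] ^ 2) := by
            rw [← Real.exp_sum, Finset.mul_sum]
        _ ≤ _ := by
            apply Real.exp_le_exp.2
            rw [← sq_abs s, hs]
            refine (mul_le_mul_of_nonneg_left hFY (by positivity)).trans (le_of_eq ?_)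
            field_simp
  have habs : |1 / (4 * F)| = 1 / (4 * F) := abs_of_pos (by positivity)
  obtain ⟨i1, b1⟩ := hS (1 / (4 * F)) habs
  obtain ⟨i2, b2⟩ := hS (-(1 / (4 * F))) (by rw [abs_neg, habs])
  have u1 := measure_ge_le_exp_mul_mgf t (by positivity) i1
  have u2 := measure_le_le_exp_mul_mgf (-t) (by rw [neg_nonpos]; positivity) i2
  have hsub : {x | t ≤ |∑ i, (Y i x ^ 2 - Var[Y i; P])|} ⊆
      {x | t ≤ ∑ i, (Y i x ^ 2 - Var[Y i; P])} ∪
        {x | ∑ i, (Y i x ^ 2 - Var[Y i; P]) ≤ -t} := by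
    intro x hx
    rcases le_abs.1 (show t ≤ |_| from hx) with h | h
    · exact Or.inl h
    · exact Or.inr (show _ ≤ -t by linarith)
  have e : Real.exp (1 / 4 - t / (4 * F)) =
      Real.exp (-(1 / (4 * F)) * t) * Real.exp (1 / 4) := by
    rw [← Real.exp_add]; congr 1; ring
  calc _ ≤ _ := measureReal_mono hsub
    _ ≤ _ := measureReal_union_le _ _
    _ ≤ Real.exp (-(1 / (4 * F)) * t) * Real.exp (1 / 4) +
        Real.exp (-(1 / (4 * F)) * t) * Real.exp (1 / 4) := by
        refine add_le_add (u1.trans (mul_le_mul_of_nonneg_left b1 (Real.exp_pos _).le)) ?_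
        have : -(-(1 / (4 * F))) * -t = -(1 / (4 * F)) * t := by ring
        rw [this] at u2
        exact u2.trans (mul_le_mul_of_nonneg_left b2 (Real.exp_pos _).le)
    _ = _ := by rw [e]; ring

theorem Matrix.IsHermitian.exists_transpose_mul_mul_eq_diagonal {ι : Type*} [Fintype ι]
    [DecidableEq ι] {M : Matrix ι ι ℝ} (hM : M.IsHermitian) :
    ∃ (U : Matrix ι ι ℝ) (d : ι → ℝ), U * U.transpose = 1 ∧
      U.transpose * M * U = Matrix.diagonal d := by
  refine ⟨hM.eigenvectorUnitary.1, hM.eigenvalues, ?_, ?_⟩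
  · exact Unitary.coe_mul_star_self hM.eigenvectorUnitary
  · have := hM.conjStarAlgAut_star_eigenvectorUnitary
    rw [Unitary.conjStarAlgAut_star_apply] at this
    exact this

/-- Exponential concentration of the squared norm of a centered Gaussian vector `X`, in terms of
the Hilbert-Schmidt norm of its covariance matrix. -/
theorem measure_abs_sum_sq_sub_integral_ge_le {Ω : Type*} [MeasurableSpace Ω] {P : Measure Ω}
    [IsProbabilityMeasure P] {ι : Type*} [Fintype ι] [DecidableEq ι] {X : ι → Ω → ℝ}
    (hX : HasGaussianLaw (fun x i => X i x) P) (hX0 : ∀ i, ∫ x, X i x ∂P = 0)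
    {F : ℝ} (hF : 0 < F) (hFX : ∑ i, ∑ j, (∫ x, X i x * X j x ∂P) ^ 2 ≤ F ^ 2) (t : ℝ) :
    P.real {x | t ≤ |∑ i, X i x ^ 2 - ∑ i, ∫ x, X i x * X i x ∂P|} ≤
      2 * Real.exp (1 / 4 - t / (4 * F)) := by
  set M : Matrix ι ι ℝ := Matrix.of fun i j => ∫ x, X i x * X j x ∂P with hMdef
  have hM : M.IsHermitian := by
    ext i j
    simp only [hMdef, Matrix.conjTranspose_apply, Matrix.of_apply, star_trivial]
    simp only [mul_comm]
  obtain ⟨U, d, hUU, hUMU⟩ := hM.exists_transpose_mul_mul_eq_diagonal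
  have hL2 : ∀ i, MemLp (X i) 2 P := fun i => (hX.eval i).memLp_two
  have hint : ∀ i j, Integrable (fun x => X i x * X j x) P := fun i j =>
    (hL2 i).integrable_mul (hL2 j)
  -- In an orthonormal eigenbasis of the covariance matrix the coordinates are uncorrelated, hence
  -- independent by joint Gaussianity, while the sum of squares is unchanged. The traces of `M` and
  -- `M * M` give the sum of the variances and the sum of their squares.
  obtain ⟨Y, hYdef⟩ : ∃ Y : ι → Ω → ℝ, ∀ j x, Y j x = ∑ i, U i j * X i x := ⟨_, fun _ _ => rfl⟩
  have hYvec : HasGaussianLaw (fun x j => Y j x) P := by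
    have := hX.map_fun (LinearMap.toContinuousLinearMap (Matrix.toLin' U.transpose))
    have e : (fun x j => Y j x) = fun x =>
        LinearMap.toContinuousLinearMap (Matrix.toLin' U.transpose) (fun i => X i x) := by
      ext x j; simp [hYdef, Matrix.mulVec, dotProduct]
    rwa [e]
  have hY0 : ∀ j, ∫ x, Y j x ∂P = 0 := fun j => by
    simp only [hYdef]
    rw [integral_finsetSum _ fun i _ => ((hX.eval i).integrable.const_mul _)]
    simp [integral_const_mul, hX0]
  have hint' : ∀ j k i l, Integrable (fun x => U i j * X i x * (U l k * X l x)) P :=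
    fun j k i l => ((hint i l).const_mul (U i j * U l k)).congr
      (Eventually.of_forall fun x => by simp only; ring)
  have hYY : ∀ j k, ∫ x, Y j x * Y k x ∂P = Matrix.diagonal d j k := fun j k => by
    rw [← hUMU]
    simp only [hYdef, Finset.sum_mul_sum, Matrix.mul_apply, Matrix.transpose_apply, hMdef,
      Matrix.of_apply]
    rw [integral_finsetSum _ fun i _ => integrable_finsetSum _ fun l _ => hint' j k i l]
    simp_rw [Finset.sum_mul]
    rw [Finset.sum_comm]
    refine Finset.sum_congr rfl fun i _ => ?_
    rw [integral_finsetSum _ fun l _ => hint' j k i l]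
    refine Finset.sum_congr rfl fun l _ => ?_
    rw [← integral_const_mul, ← integral_mul_const]
    congr 1; ext x; ring
  have hcov : ∀ j k, cov[Y j, Y k; P] = Matrix.diagonal d j k := fun j k => by
    rw [← hYY, covariance_eq_sub (hYvec.eval j).memLp_two (hYvec.eval k).memLp_two, hY0]
    simp
  have hvar : ∀ j, Var[Y j; P] = d j := fun j => by
    rw [← covariance_self (hYvec.eval j).aemeasurable, hcov]; simp
  have hind : iIndepFun Y P := hYvec.iIndepFun_of_covariance_eq_zero fun j k hjk => by
    rw [hcov, Matrix.diagonal_apply_ne _ hjk]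
  have hsumd : ∑ i, d i = ∑ i, ∫ x, X i x * X i x ∂P := by
    have h : (Matrix.diagonal d).trace = M.trace := by
      rw [← hUMU, Matrix.mul_assoc, Matrix.trace_mul_comm, Matrix.mul_assoc, hUU, Matrix.mul_one]
    simpa [Matrix.trace, hMdef] using h
  have hsumd2 : ∑ i, d i ^ 2 ≤ F ^ 2 := by
    have h : (Matrix.diagonal d * Matrix.diagonal d).trace = (M * M).trace := by
      rw [← hUMU]
      have : U.transpose * M * U * (U.transpose * M * U) = U.transpose * (M * M * U) := by
        calc _ = U.transpose * M * (U * U.transpose) * M * U := by simp only [Matrix.mul_assoc]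
          _ = _ := by rw [hUU]; simp only [Matrix.mul_assoc, Matrix.one_mul]
      rw [this, Matrix.trace_mul_comm, Matrix.mul_assoc, hUU, Matrix.mul_one]
    have h1 : (M * M).trace = ∑ i, ∑ j, (∫ x, X i x * X j x ∂P) ^ 2 := by
      simp only [Matrix.trace, Matrix.diag_apply, Matrix.mul_apply, hMdef, Matrix.of_apply, sq]
      refine Finset.sum_congr rfl fun i _ => Finset.sum_congr rfl fun j _ => ?_
      congr 2; ext x; ring
    have h2 : (Matrix.diagonal d * Matrix.diagonal d).trace = ∑ i, d i ^ 2 := by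
      simp [Matrix.trace, sq]
    rw [← h2, h, h1]
    exact hFX
  have hsq : ∀ x, ∑ j, Y j x ^ 2 = ∑ i, X i x ^ 2 := fun x => by
    have hY' : (fun j => Y j x) = Matrix.mulVec U.transpose (fun i => X i x) := by
      ext j; simp [hYdef, Matrix.mulVec, dotProduct]
    have : (fun j => Y j x) ⬝ᵥ (fun j => Y j x) = (fun i => X i x) ⬝ᵥ (fun i => X i x) := by
      rw [hY', Matrix.mulVec_transpose, ← Matrix.dotProduct_mulVec, ← Matrix.mulVec_transpose,
        Matrix.mulVec_mulVec, hUU, Matrix.one_mulVec]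
    simpa [dotProduct, sq] using this
  have := measure_abs_sum_sq_sub_variance_ge_le (fun j => hYvec.eval j) hY0 hind hF
    (by simpa only [hvar] using hsumd2) t
  simp only [hvar, Finset.sum_sub_distrib, hsq, hsumd] at this
  exact this

/-! ### Stability of Gaussian laws under limits in L². -/

theorem MeasureTheory.MemLp.toReal_eLpNorm_two_sq {α E : Type*} [MeasurableSpace α]
    [NormedAddCommGroup E] {μ : Measure α} {f : α → E} (hf : MemLp f 2 μ) :
    (eLpNorm f 2 μ).toReal ^ 2 = ∫ x, ‖f x‖ ^ 2 ∂μ := by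
  rw [hf.eLpNorm_eq_integral_rpow_norm (by norm_num) (by norm_num),
    ENNReal.toReal_ofReal (by positivity)]
  have h0 : 0 ≤ ∫ x, ‖f x‖ ^ 2 ∂μ := integral_nonneg fun x => by positivity
  simp only [ENNReal.toReal_ofNat, Real.rpow_ofNat]
  rw [← Real.rpow_natCast, ← Real.rpow_mul h0]
  norm_num

theorem MeasureTheory.tendsto_eLpNorm_of_tendsto_sub {α E : Type*} [MeasurableSpace α]
    [NormedAddCommGroup E] {μ : Measure α} {p : ℝ≥0∞} (hp : 1 ≤ p) {f : α → E} {u : ℕ → α → E}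
    (hf : MemLp f p μ) (hu : ∀ n, AEStronglyMeasurable (u n) μ)
    (h : Tendsto (fun n => eLpNorm (f - u n) p μ) atTop (𝓝 0)) :
    Tendsto (fun n => eLpNorm (u n) p μ) atTop (𝓝 (eLpNorm f p μ)) := by
  refine tendsto_of_tendsto_of_tendsto_of_le_of_le
    (g := fun n => eLpNorm f p μ - eLpNorm (f - u n) p μ)
    (h := fun n => eLpNorm f p μ + eLpNorm (f - u n) p μ) ?_ ?_ (fun n => ?_) (fun n => ?_)
  · simpa using ENNReal.Tendsto.sub (tendsto_const_nhds (x := eLpNorm f p μ)) h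
      (Or.inl hf.eLpNorm_ne_top)
  · simpa using tendsto_const_nhds.add h
  · refine tsub_le_iff_left.2 ?_
    have := eLpNorm_add_le (hf.1.sub (hu n)) (hu n) hp
    simpa using this
  · have := eLpNorm_sub_le hf.1 (hf.1.sub (hu n)) hp
    simpa using this

/-- A limit in `L²` of real Gaussian random variables is Gaussian. -/
theorem ProbabilityTheory.HasGaussianLaw.of_tendsto_eLpNorm {Ω : Type*} [MeasurableSpace Ω]
    {P : Measure Ω} [IsProbabilityMeasure P] {Y : Ω → ℝ} {u : ℕ → Ω → ℝ}
    (hu : ∀ n, HasGaussianLaw (u n) P) (hY : MemLp Y 2 P)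
    (h : Tendsto (fun n => eLpNorm (Y - u n) 2 P) atTop (𝓝 0)) : HasGaussianLaw Y P := by
  have hYm : AEMeasurable Y P := hY.1.aemeasurable
  have hL1 : Tendsto (fun n => ∫ x, ‖Y x - u n x‖ ∂P) atTop (𝓝 0) := by
    have : Tendsto (fun n => (eLpNorm (Y - u n) 2 P).toReal) atTop (𝓝 0) := by
      have := (ENNReal.tendsto_toReal ENNReal.zero_ne_top).comp h
      rwa [ENNReal.toReal_zero] at this
    refine squeeze_zero (fun n => integral_nonneg fun x => norm_nonneg _) (fun n => ?_) this
    have hm : MemLp (Y - u n) 2 P := hY.sub (hu n).memLp_two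
    have h1 := eLpNorm_le_eLpNorm_of_exponent_le (p := 1) (q := 2) (by norm_num) hm.1
    have h2 := ENNReal.toReal_mono hm.eLpNorm_ne_top h1
    rwa [eLpNorm_one_eq_lintegral_enorm, ← integral_norm_eq_lintegral_enorm hm.1] at h2
  have hI : ∀ n, Integrable (u n) P := fun n => (hu n).integrable
  have hYI : Integrable Y P := hY.integrable (by norm_num)
  have hmean : Tendsto (fun n => ∫ x, u n x ∂P) atTop (𝓝 (∫ x, Y x ∂P)) := by
    rw [tendsto_iff_norm_sub_tendsto_zero]
    refine squeeze_zero (fun n => norm_nonneg _) (fun n => ?_) hL1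
    rw [← integral_sub (hI n) hYI]
    refine (norm_integral_le_integral_norm _).trans (le_of_eq ?_)
    simp only [norm_sub_rev]
  have hsq : Tendsto (fun n => ∫ x, (u n x) ^ 2 ∂P) atTop (𝓝 (∫ x, (Y x) ^ 2 ∂P)) := by
    have h1 := tendsto_eLpNorm_of_tendsto_sub (by norm_num) hY (fun n => (hu n).memLp_two.1) h
    have h2 := ((ENNReal.tendsto_toReal hY.eLpNorm_ne_top).comp h1).pow 2
    simp only [Function.comp_apply, hY.toReal_eLpNorm_two_sq,
      (hu _).memLp_two.toReal_eLpNorm_two_sq] at h2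
    simpa using h2
  have hvar : Tendsto (fun n => Var[u n; P]) atTop (𝓝 Var[Y; P]) := by
    rw [variance_eq_sub hY]
    simp_rw [fun n => variance_eq_sub (hu n).memLp_two]
    exact hsq.sub (hmean.pow 2)
  rw [hasGaussianLaw_iff_charFun_map_eq hYm]
  intro t
  have hint : ∀ Z : Ω → ℝ, AEMeasurable Z P →
      charFun (P.map Z) t = ∫ x, Complex.exp (t * Z x * Complex.I) ∂P := fun Z hZ => by
    rw [charFun_apply_real, integral_map hZ (by fun_prop)]
  have hexpI : ∀ Z : Ω → ℝ, AEMeasurable Z P →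
      Integrable (fun x => Complex.exp (t * Z x * Complex.I)) P := fun Z hZ => by
    refine Integrable.of_bound (C := 1) (by fun_prop) (Eventually.of_forall fun x => ?_)
    rw [← Complex.ofReal_mul, Complex.norm_exp_ofReal_mul_I]
  -- Characteristic functions converge by `|exp(ia) - exp(ib)| ≤ |a - b|` and L¹ convergence. On the
  -- Gaussian side they are functions of mean and variance, which converge too.
  have hlhs : Tendsto (fun n => charFun (P.map (u n)) t) atTop (𝓝 (charFun (P.map Y) t)) := by
    simp only [hint _ hYm, fun n => hint _ (hu n).aemeasurable]
    rw [tendsto_iff_norm_sub_tendsto_zero]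
    have h3 : Tendsto (fun n => |t| * ∫ x, ‖Y x - u n x‖ ∂P) atTop (𝓝 0) := by
      simpa using hL1.const_mul |t|
    refine squeeze_zero (fun n => norm_nonneg _) (fun n => ?_) h3
    rw [← integral_sub (hexpI _ (hu n).aemeasurable) (hexpI _ hYm), ← integral_const_mul]
    refine (norm_integral_le_integral_norm _).trans (integral_mono_of_nonneg
      (Eventually.of_forall fun x => norm_nonneg _) ((hYI.sub (hI n)).norm.const_mul _)
      (Eventually.of_forall fun x => ?_))
    have e : Complex.exp (t * u n x * Complex.I) - Complex.exp (t * Y x * Complex.I) =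
        Complex.exp ((t * Y x : ℝ) * Complex.I) *
          (Complex.exp (Complex.I * (t * (u n x - Y x) : ℝ)) - 1) := by
      rw [mul_sub, ← Complex.exp_add, mul_one]
      push_cast
      congr 2; ring
    simp only [e, norm_mul, Complex.norm_exp_ofReal_mul_I, one_mul]
    refine Real.norm_exp_I_mul_ofReal_sub_one_le.trans (le_of_eq ?_)
    rw [norm_mul, norm_sub_rev, Real.norm_eq_abs]
  refine tendsto_nhds_unique hlhs ?_
  simp only [(hu _).charFun_map_eq]
  have hin : ∀ (n : ℕ), (fun x => inner ℝ t (u n x)) = fun x => t * u n x := fun n => by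
    ext x; simp [mul_comm]
  have hin' : (fun x => inner ℝ t (Y x)) = fun x => t * Y x := by
    ext x; simp [mul_comm]
  simp only [hin, hin', integral_const_mul, variance_const_mul]
  refine (Complex.continuous_exp.tendsto _).comp (Tendsto.sub ?_ ?_)
  · exact ((Complex.continuous_ofReal.tendsto _).comp (hmean.const_mul t)).mul_const _
  · exact ((Complex.continuous_ofReal.tendsto _).comp (hvar.const_mul (t ^ 2))).div_const _

theorem ProbabilityTheory.HasGaussianLaw.of_forall_strongDual {Ω : Type*} [MeasurableSpace Ω]
    {P : Measure Ω} [IsProbabilityMeasure P] {E : Type*} [NormedAddCommGroup E] [NormedSpace ℝ E]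
    [MeasurableSpace E] [BorelSpace E] {X : Ω → E} (hX : AEMeasurable X P)
    (h : ∀ L : StrongDual ℝ E, HasGaussianLaw (fun x => L (X x)) P) : HasGaussianLaw X P := by
  constructor
  constructor
  intro L
  have hL : Measurable L := L.continuous.measurable
  rw [AEMeasurable.map_map_of_aemeasurable hL.aemeasurable hX]
  have := (h L).map_eq_gaussianReal
  rw [variance_map hL.aemeasurable hX, integral_map hX hL.aestronglyMeasurable]
  exact this

/-- A coordinatewise limit in `L²` of Gaussian vectors is Gaussian. -/
theorem ProbabilityTheory.HasGaussianLaw.pi_of_tendsto_eLpNorm {Ω : Type*} [MeasurableSpace Ω]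
    {P : Measure Ω} [IsProbabilityMeasure P] {ι : Type*} [Fintype ι] {X : ι → Ω → ℝ}
    {u : ℕ → ι → Ω → ℝ} (hu : ∀ n, HasGaussianLaw (fun x i => u n i x) P)
    (hX : ∀ i, MemLp (X i) 2 P)
    (h : ∀ i, Tendsto (fun n => eLpNorm (X i - u n i) 2 P) atTop (𝓝 0)) :
    HasGaussianLaw (fun x i => X i x) P := by
  classical
  refine .of_forall_strongDual (aemeasurable_pi_lambda _ fun i => (hX i).1.aemeasurable)
    fun L => ?_
  obtain ⟨c, hL⟩ : ∃ c : ι → ℝ, ∀ y : ι → ℝ, L y = ∑ i, c i * y i := by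
    refine ⟨fun i => L (Pi.single i 1), fun y => ?_⟩
    conv_lhs => rw [← Finset.univ_sum_single y, map_sum]
    refine Finset.sum_congr rfl fun i _ => ?_
    have : Pi.single i (y i) = y i • (Pi.single i 1 : ι → ℝ) := by
      rw [← Pi.single_smul, smul_eq_mul, mul_one]
    rw [this, map_smul, smul_eq_mul, mul_comm]
  refine .of_tendsto_eLpNorm (u := fun n x => L (fun i => u n i x)) (fun n => (hu n).map_fun L)
    ?_ ?_
  · simp only [hL]
    exact memLp_finsetSum _ fun i _ => (hX i).const_mul _
  · have hlim : Tendsto (fun n => ∑ i, ‖c i‖ₑ * eLpNorm (X i - u n i) 2 P)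
        atTop (𝓝 0) := by
      have := tendsto_finsetSum (Finset.univ : Finset ι) fun i _ =>
        ENNReal.Tendsto.const_mul (a := ‖c i‖ₑ) (h i) (Or.inr enorm_ne_top)
      simpa using this
    refine tendsto_of_tendsto_of_tendsto_of_le_of_le tendsto_const_nhds hlim
      (fun n => zero_le) fun n => ?_
    have e : ((fun x => L fun i => X i x) - fun x => L fun i => u n i x) =
        ∑ i, c i • (X i - u n i) := by
      ext x
      simp only [Pi.sub_apply, hL, Finset.sum_apply, Pi.smul_apply, smul_eq_mul,
        ← Finset.sum_sub_distrib, mul_sub]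
    rw [e]
    refine (eLpNorm_sum_le (fun i _ => ?_) (by norm_num)).trans
      (Finset.sum_le_sum fun i _ => (eLpNorm_const_smul _ _ _ _).le)
    exact ((hX i).1.sub ((hu n).eval i).memLp_two.1).const_smul _

/-! ### The stochastic integral: isometry and Gaussianity. -/

namespace AFBM

section

variable {Ω : Type*} [MeasurableSpace Ω] {P : Measure Ω} {d : ℕ}
  {W : Set (EuclideanSpace ℝ (Fin d)) → Ω → ℂ}

theorem IsHermitianGaussianMeasure.memLp_two (hW : IsHermitianGaussianMeasure P W)
    {B : Set (EuclideanSpace ℝ (Fin d))} (hB : MeasurableSet B) (hB' : volume B < ∞) :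
    MemLp (W B) 2 P :=
  (hW.gaussian.hasGaussianLaw_eval ⟨B, hB, hB'⟩).memLp_two

theorem volume_preimage_lt_top {s : SimpleFunc (EuclideanSpace ℝ (Fin d)) ℂ}
    (hs : MemLp s 2 volume) {c : ℂ} (hc : c ≠ 0) : volume (s ⁻¹' {c}) < ∞ :=
  SimpleFunc.measure_preimage_lt_top_of_memLp (by norm_num) (by norm_num) s hs c hc

theorem IsHermitianGaussianMeasure.memLp_const_mul (hW : IsHermitianGaussianMeasure P W)
    {s : SimpleFunc (EuclideanSpace ℝ (Fin d)) ℂ} (hs : MemLp s 2 volume) (c : ℂ) :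
    MemLp (fun x => c * W (s ⁻¹' {c}) x) 2 P := by
  rcases eq_or_ne c 0 with rfl | hc
  · simp
  · exact (hW.memLp_two (s.measurableSet_preimage _) (volume_preimage_lt_top hs hc)).const_mul c

theorem IsHermitianGaussianMeasure.memLp_simpleIntegral (hW : IsHermitianGaussianMeasure P W)
    {s : SimpleFunc (EuclideanSpace ℝ (Fin d)) ℂ} (hs : MemLp s 2 volume) :
    MemLp (simpleIntegral W s) 2 P :=
  memLp_finsetSum _ fun c _ => hW.memLp_const_mul hs c

theorem IsHermitianGaussianMeasure.integral_simpleIntegral (hW : IsHermitianGaussianMeasure P W)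
    [IsProbabilityMeasure P] {s : SimpleFunc (EuclideanSpace ℝ (Fin d)) ℂ}
    (hs : MemLp s 2 volume) : ∫ x, simpleIntegral W s x ∂P = 0 := by
  simp only [simpleIntegral]
  rw [integral_finsetSum _ fun c _ => (hW.memLp_const_mul hs c).integrable (by norm_num)]
  refine Finset.sum_eq_zero fun c _ => ?_
  rcases eq_or_ne c 0 with rfl | hc
  · simp
  · rw [integral_const_mul,
      hW.centered _ (s.measurableSet_preimage _) (volume_preimage_lt_top hs hc), mul_zero]

theorem simpleFunc_eq_sum_indicator (s : SimpleFunc (EuclideanSpace ℝ (Fin d)) ℂ)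
    (ξ : EuclideanSpace ℝ (Fin d)) :
    s ξ = ∑ c ∈ s.range, (s ⁻¹' {c}).indicator (fun _ => c) ξ := by
  rw [Finset.sum_eq_single (s ξ)]
  · simp
  · intro c _ hc
    exact Set.indicator_of_notMem (fun h => hc h.symm) _
  · intro h; exact absurd (s.mem_range_self ξ) h

/-- Both sides expand over pairs of level sets and agree term by term by the covariance of `W`. The
value `0` is set apart because its level set may have infinite volume, where nothing is known about
`W`. -/
theorem IsHermitianGaussianMeasure.integral_simpleIntegral_mul_conj
    (hW : IsHermitianGaussianMeasure P W)
    {s t : SimpleFunc (EuclideanSpace ℝ (Fin d)) ℂ} (hs : MemLp s 2 volume)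
    (ht : MemLp t 2 volume) :
    ∫ x, simpleIntegral W s x * conj (simpleIntegral W t x) ∂P = ∫ ξ, s ξ * conj (t ξ) := by
  have hL : ∫ x, simpleIntegral W s x * conj (simpleIntegral W t x) ∂P =
      ∑ c ∈ s.range, ∑ e ∈ t.range, c * conj e *
        ((volume (s ⁻¹' {c} ∩ t ⁻¹' {e})).toReal : ℂ) := by
    simp only [simpleIntegral, map_sum, Finset.sum_mul_sum]
    have hi : ∀ c e, Integrable
        (fun x => c * W (s ⁻¹' {c}) x * conj (e * W (t ⁻¹' {e}) x)) P := fun c e =>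
      (hW.memLp_const_mul hs c).integrable_mul (hW.memLp_const_mul ht e).star
    rw [integral_finsetSum _ fun c _ => integrable_finsetSum _ fun e _ => hi c e]
    refine Finset.sum_congr rfl fun c _ => ?_
    rw [integral_finsetSum _ fun e _ => hi c e]
    refine Finset.sum_congr rfl fun e _ => ?_
    rcases eq_or_ne c 0 with rfl | hc
    · simp
    rcases eq_or_ne e 0 with rfl | he
    · simp
    rw [← hW.covariance _ _ (s.measurableSet_preimage _) (volume_preimage_lt_top hs hc)
      (t.measurableSet_preimage _) (volume_preimage_lt_top ht he), ← integral_const_mul]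
    congr 1; ext x
    rw [map_mul]; ring
  have hR : ∫ ξ, s ξ * conj (t ξ) =
      ∑ c ∈ s.range, ∑ e ∈ t.range, c * conj e *
        ((volume (s ⁻¹' {c} ∩ t ⁻¹' {e})).toReal : ℂ) := by
    have key : ∀ ξ, s ξ * conj (t ξ) = ∑ c ∈ s.range, ∑ e ∈ t.range,
        (s ⁻¹' {c} ∩ t ⁻¹' {e}).indicator (fun _ => c * conj e) ξ := fun ξ => by
      conv_lhs => rw [simpleFunc_eq_sum_indicator s, simpleFunc_eq_sum_indicator t]
      rw [map_sum, Finset.sum_mul_sum]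
      refine Finset.sum_congr rfl fun c _ => Finset.sum_congr rfl fun e _ => ?_
      by_cases h1 : ξ ∈ s ⁻¹' {c} <;> by_cases h2 : ξ ∈ t ⁻¹' {e} <;>
        simp only [Set.indicator, Set.mem_inter_iff, h1, h2, if_true, if_false, and_true,
          and_false, map_zero, mul_zero, zero_mul]
    have hm : ∀ c e, MeasurableSet (s ⁻¹' {c} ∩ t ⁻¹' {e}) := fun c e =>
      (s.measurableSet_preimage _).inter (t.measurableSet_preimage _)
    have hi : ∀ c e, Integrable
        ((s ⁻¹' {c} ∩ t ⁻¹' {e}).indicator (fun _ => c * conj e)) volume := fun c e => by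
      rcases eq_or_ne c 0 with rfl | hc
      · simp
      · exact (integrable_indicator_iff (hm c e)).2 (integrableOn_const
          (((measure_mono Set.inter_subset_left).trans_lt (volume_preimage_lt_top hs hc)).ne))
    simp only [key]
    rw [integral_finsetSum _ fun c _ => integrable_finsetSum _ fun e _ => hi c e]
    refine Finset.sum_congr rfl fun c _ => ?_
    rw [integral_finsetSum _ fun e _ => hi c e]
    refine Finset.sum_congr rfl fun e _ => ?_
    rw [integral_indicator_const _ (hm c e), Complex.real_smul, mul_comm]
    rfl
  rw [hL, hR]

end

theorem _root_.MeasureTheory.MemLp.integral_norm_sub_sq {α : Type*} [MeasurableSpace α]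
    {μ : Measure α} {f g : α → ℂ} (hf : MemLp f 2 μ) (hg : MemLp g 2 μ) :
    ((∫ x, ‖f x - g x‖ ^ 2 ∂μ : ℝ) : ℂ) = ∫ x, f x * conj (f x) ∂μ - ∫ x, f x * conj (g x) ∂μ -
      ∫ x, g x * conj (f x) ∂μ + ∫ x, g x * conj (g x) ∂μ := by
  have hff : Integrable (fun x => f x * conj (f x)) μ := hf.integrable_mul hf.star
  have hfg : Integrable (fun x => f x * conj (g x)) μ := hf.integrable_mul hg.star
  have hgf : Integrable (fun x => g x * conj (f x)) μ := hg.integrable_mul hf.star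
  have hgg : Integrable (fun x => g x * conj (g x)) μ := hg.integrable_mul hg.star
  have e1 := integral_sub hff hfg
  have e2 := integral_sub (hff.sub hfg) hgf
  have e3 := integral_add ((hff.sub hfg).sub hgf) hgg
  simp only [Pi.sub_apply] at e1 e2 e3
  rw [← e1, ← e2, ← e3, ← integral_complex_ofReal]
  congr 1; ext x
  rw [Complex.ofReal_pow, ← Complex.mul_conj', map_sub]
  ring

theorem _root_.MeasureTheory.eLpNorm_sub_le_eLpNorm_sub_add {α : Type*} [MeasurableSpace α]
    {μ : Measure α} {a b a' b' : α → ℂ} {η : ℝ≥0∞} (ha : AEStronglyMeasurable a μ)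
    (hb : AEStronglyMeasurable b μ) (ha' : AEStronglyMeasurable a' μ)
    (hb' : AEStronglyMeasurable b' μ) (h1 : eLpNorm (a - a') 2 μ ≤ η)
    (h2 : eLpNorm (b - b') 2 μ ≤ η) :
    eLpNorm (a - b) 2 μ ≤ eLpNorm (a' - b') 2 μ + (η + η) := by
  have e : a - b = (a' - b') + ((a - a') - (b - b')) := by abel
  rw [e]
  refine (eLpNorm_add_le (ha'.sub hb') ((ha.sub ha').sub (hb.sub hb')) (by norm_num)).trans ?_
  gcongr
  exact (eLpNorm_sub_le (ha.sub ha') (hb.sub hb') (by norm_num)).trans (add_le_add h1 h2)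

section

variable {Ω : Type*} [MeasurableSpace Ω] {P : Measure Ω} {d : ℕ}
  {W : Set (EuclideanSpace ℝ (Fin d)) → Ω → ℂ}

theorem IsHermitianGaussianMeasure.eLpNorm_simpleIntegral_sub
    (hW : IsHermitianGaussianMeasure P W)
    {s t : SimpleFunc (EuclideanSpace ℝ (Fin d)) ℂ} (hs : MemLp s 2 volume)
    (ht : MemLp t 2 volume) :
    eLpNorm (simpleIntegral W s - simpleIntegral W t) 2 P = eLpNorm (⇑s - ⇑t) 2 volume := by
  have hIs := hW.memLp_simpleIntegral hs
  have hIt := hW.memLp_simpleIntegral ht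
  have h : ∫ x, ‖simpleIntegral W s x - simpleIntegral W t x‖ ^ 2 ∂P = ∫ ξ, ‖s ξ - t ξ‖ ^ 2 := by
    apply Complex.ofReal_injective
    rw [hIs.integral_norm_sub_sq hIt, hs.integral_norm_sub_sq ht]
    simp only [hW.integral_simpleIntegral_mul_conj, hs, ht]
  rw [← ENNReal.toReal_eq_toReal_iff' (hIs.sub hIt).eLpNorm_ne_top (hs.sub ht).eLpNorm_ne_top,
    ← sq_eq_sq₀ ENNReal.toReal_nonneg ENNReal.toReal_nonneg, (hIs.sub hIt).toReal_eLpNorm_two_sq,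
    (hs.sub ht).toReal_eLpNorm_two_sq]
  exact h

theorem IsStochasticIntegral.memLp_two (hW : IsHermitianGaussianMeasure P W)
    {f : EuclideanSpace ℝ (Fin d) → ℂ} {X : Ω → ℂ} (hX : IsStochasticIntegral P W f X) :
    MemLp X 2 P := by
  obtain ⟨s, hs, -, h⟩ := hX.2 1 one_pos
  have hI := hW.memLp_simpleIntegral hs
  have : MemLp (fun x => X x - simpleIntegral W s x) 2 P :=
    ⟨hX.1.sub hI.1, h.trans_lt ENNReal.one_lt_top⟩
  convert this.add hI
  ext x; simp

/-- The isometry for simple functions survives approximation. Only differences are compared, so no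
linearity of the relation `IsStochasticIntegral` has to be established. -/
theorem IsStochasticIntegral.eLpNorm_sub (hW : IsHermitianGaussianMeasure P W)
    {f g : EuclideanSpace ℝ (Fin d) → ℂ} {X Y : Ω → ℂ}
    (hf : AEStronglyMeasurable f volume) (hg : AEStronglyMeasurable g volume)
    (hX : IsStochasticIntegral P W f X) (hY : IsStochasticIntegral P W g Y) :
    eLpNorm (X - Y) 2 P = eLpNorm (f - g) 2 volume := by
  have key : ∀ η : ℝ≥0∞, 0 < η → eLpNorm (X - Y) 2 P ≤ eLpNorm (f - g) 2 volume + 4 * η ∧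
      eLpNorm (f - g) 2 volume ≤ eLpNorm (X - Y) 2 P + 4 * η := by
    intro η hη
    obtain ⟨s, hs, hs1, hs2⟩ := hX.2 η hη
    obtain ⟨t, ht, ht1, ht2⟩ := hY.2 η hη
    have hiso := hW.eLpNorm_simpleIntegral_sub hs ht
    have mIs := (hW.memLp_simpleIntegral hs).1
    have mIt := (hW.memLp_simpleIntegral ht).1
    have h4 : (4 : ℝ≥0∞) * η = (η + η) + (η + η) := by ring
    constructor
    · refine (eLpNorm_sub_le_eLpNorm_sub_add hX.1 hY.1 mIs mIt hs2 ht2).trans ?_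
      rw [hiso, h4, ← add_assoc (eLpNorm (f - g) 2 volume)]
      exact add_le_add (eLpNorm_sub_le_eLpNorm_sub_add hs.1 ht.1 hf hg
        ((eLpNorm_sub_comm _ _ _ _).trans_le hs1) ((eLpNorm_sub_comm _ _ _ _).trans_le ht1)) le_rfl
    · refine (eLpNorm_sub_le_eLpNorm_sub_add hf hg hs.1 ht.1 hs1 ht1).trans ?_
      rw [← hiso, h4, ← add_assoc (eLpNorm (X - Y) 2 P)]
      exact add_le_add (eLpNorm_sub_le_eLpNorm_sub_add mIs mIt hX.1 hY.1
        ((eLpNorm_sub_comm _ _ _ _).trans_le hs2) ((eLpNorm_sub_comm _ _ _ _).trans_le ht2)) le_rfl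
  have h4 : ∀ δ : NNReal, 0 < δ → (4 : ℝ≥0∞) * ((δ : ℝ≥0∞) / 4) = δ := fun δ _ =>
    ENNReal.mul_div_cancel (by norm_num) (by norm_num)
  have hpos : ∀ δ : NNReal, 0 < δ → (0 : ℝ≥0∞) < (δ : ℝ≥0∞) / 4 := fun δ hδ =>
    ENNReal.div_pos (by simpa using hδ.ne') (by norm_num)
  apply le_antisymm
  · refine ENNReal.le_of_forall_pos_le_add fun δ hδ _ => ?_
    simpa only [h4 δ hδ] using (key _ (hpos δ hδ)).1
  · refine ENNReal.le_of_forall_pos_le_add fun δ hδ _ => ?_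
    simpa only [h4 δ hδ] using (key _ (hpos δ hδ)).2

/-- The integrals of square integrable simple functions form a Gaussian process. -/
theorem IsHermitianGaussianMeasure.isGaussianProcess_simpleIntegral
    (hW : IsHermitianGaussianMeasure P W) :
    IsGaussianProcess (fun s : {s : SimpleFunc (EuclideanSpace ℝ (Fin d)) ℂ //
      MemLp s 2 volume} => simpleIntegral W s.1) P := by
  classical
  refine hW.gaussian.of_isGaussianProcess fun s => ?_
  have hfin : ∀ c ∈ s.1.range.filter (· ≠ 0), MeasurableSet (s.1 ⁻¹' {c}) ∧
      volume (s.1 ⁻¹' {c}) < ∞ := fun c hc =>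
    ⟨s.1.measurableSet_preimage _, volume_preimage_lt_top s.2 (Finset.mem_filter.1 hc).2⟩
  -- The integral is a fixed linear form in finitely many values of `W`. The value `0` is discarded,
  -- so that all level sets involved have finite volume and are legitimate indices.
  refine ⟨(s.1.range.filter (· ≠ 0)).attach.image fun c => ⟨s.1 ⁻¹' {c.1}, hfin c.1 c.2⟩,
    ∑ c ∈ (s.1.range.filter (· ≠ 0)).attach.attach, c.1.1 • ContinuousLinearMap.proj
      ⟨⟨s.1 ⁻¹' {c.1.1}, hfin c.1.1 c.1.2⟩, Finset.mem_image_of_mem _ c.2⟩, fun x => ?_⟩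
  rw [sum_apply]
  simp only [_root_.smul_apply, ContinuousLinearMap.proj_apply,
    Finset.restrict, smul_eq_mul]
  rw [Finset.sum_attach (s.1.range.filter (· ≠ 0)).attach
      (fun c => c.1 * W (s.1 ⁻¹' {c.1}) x),
    Finset.sum_attach (s.1.range.filter (· ≠ 0)) (fun c => c * W (s.1 ⁻¹' {c}) x),
    Finset.sum_filter_of_ne]
  · rfl
  · rintro c _ h rfl
    simp at h

end

section

variable {Ω : Type*} [MeasurableSpace Ω] {P : Measure Ω} {d : ℕ}
  {W : Set (EuclideanSpace ℝ (Fin d)) → Ω → ℂ} {H : EuclideanSpace ℝ (Fin d) → ℝ}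
  {A : EuclideanSpace ℝ (Fin d) → Ω → ℝ}

theorem IsAFBM.memLp_two (hA : IsAFBM P W H A) (u : EuclideanSpace ℝ (Fin d)) :
    MemLp (A u) 2 P :=
  ((hA.2 u).memLp_two hA.1).re

/-- The field is real, so passing to real parts does not increase the approximation error. One
sequence of simple functions for each `u` lets centering and joint Gaussianity pass to the limit. -/
theorem IsAFBM.exists_approx (hA : IsAFBM P W H A) : ∃ s : ℕ → EuclideanSpace ℝ (Fin d) →
    {s : SimpleFunc (EuclideanSpace ℝ (Fin d)) ℂ // MemLp s 2 volume},
    ∀ u, Tendsto (fun n => eLpNorm (A u - fun x => (simpleIntegral W (s n u).1 x).re) 2 P)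
      atTop (𝓝 0) := by
  have h : ∀ n : ℕ, ∀ u, ∃ s : {s : SimpleFunc (EuclideanSpace ℝ (Fin d)) ℂ // MemLp s 2 volume},
      eLpNorm (A u - fun x => (simpleIntegral W s.1 x).re) 2 P ≤ ((n : ℝ≥0∞) + 1)⁻¹ := by
    intro n u
    obtain ⟨s, hs, -, h⟩ := (hA.2 u).2 ((n : ℝ≥0∞) + 1)⁻¹ (by simp)
    refine ⟨⟨s, hs⟩, (eLpNorm_mono fun x => ?_).trans h⟩
    have := Complex.abs_re_le_norm ((A u x : ℂ) - simpleIntegral W s x)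
    simpa using this
  choose s hs using h
  refine ⟨s, fun u => tendsto_of_tendsto_of_tendsto_of_le_of_le tendsto_const_nhds ?_
    (fun n => zero_le) fun n => hs n u⟩
  have := ENNReal.tendsto_inv_nat_nhds_zero.comp (tendsto_add_atTop_nat 1)
  refine this.congr fun n => ?_
  simp

theorem IsAFBM.integral_eq_zero [IsProbabilityMeasure P] (hA : IsAFBM P W H A)
    (u : EuclideanSpace ℝ (Fin d)) :
    ∫ x, A u x ∂P = 0 := by
  obtain ⟨s, hs⟩ := hA.exists_approx
  have hm : ∀ n, MemLp (fun x => (simpleIntegral W (s n u).1 x).re) 2 P := fun n =>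
    (hA.1.memLp_simpleIntegral (s n u).2).re
  have h0 : ∀ n, ∫ x, (simpleIntegral W (s n u).1 x).re ∂P = 0 := fun n => by
    have := integral_re ((hA.1.memLp_simpleIntegral (s n u).2).integrable (by norm_num))
    rw [hA.1.integral_simpleIntegral (s n u).2] at this
    simpa using this
  have hle : ∀ n, ENNReal.ofReal |∫ x, A u x ∂P| ≤
      eLpNorm (A u - fun x => (simpleIntegral W (s n u).1 x).re) 2 P := fun n => by
    have hd := (hA.memLp_two u).sub (hm n)
    refine le_trans ?_ (eLpNorm_le_eLpNorm_of_exponent_le (p := 1) (by norm_num) hd.1)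
    rw [eLpNorm_one_eq_lintegral_enorm]
    refine le_trans (le_of_eq ?_) (enorm_integral_le_lintegral_enorm _)
    simp only [Pi.sub_apply]
    rw [integral_sub ((hA.memLp_two u).integrable (by norm_num))
      ((hm n).integrable (by norm_num)), h0, sub_zero, ← ofReal_norm, Real.norm_eq_abs]
  have := ge_of_tendsto (hs u) (Eventually.of_forall hle)
  simpa using this

theorem IsAFBM.hasGaussianLaw [IsProbabilityMeasure P] (hA : IsAFBM P W H A)
    {ι : Type*} [Fintype ι] (u : ι → EuclideanSpace ℝ (Fin d)) : HasGaussianLaw (fun x i => A (u i) x) P := by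
  classical
  obtain ⟨s, hs⟩ := hA.exists_approx
  refine .pi_of_tendsto_eLpNorm (X := fun i => A (u i))
    (u := fun n i x => (simpleIntegral W (s n (u i)).1 x).re) (fun n => ?_)
    (fun i => hA.memLp_two _) fun i => hs (u i)
  have h1 : IsGaussianProcess (fun i x => (simpleIntegral W (s n (u i)).1 x).re) P :=
    (hA.1.isGaussianProcess_simpleIntegral.comp_right fun i => s n (u i)).comp_left
      fun _ => Complex.reCLM
  have h2 := (h1.hasGaussianLaw Finset.univ).map_fun
    (ContinuousLinearMap.pi fun i : ι => ContinuousLinearMap.proj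
      (⟨i, Finset.mem_univ i⟩ : (Finset.univ : Finset ι)))
  exact h2

theorem measurable_kernel (hH : Measurable H) (u : EuclideanSpace ℝ (Fin d)) :
    Measurable (kernel H u) := by
  unfold kernel
  fun_prop

theorem IsAFBM.integral_sub_sq (hA : IsAFBM P W H A) (hH : Measurable H)
    (u v : EuclideanSpace ℝ (Fin d)) :
    ∫ x, (A u x - A v x) ^ 2 ∂P = (∫⁻ ξ, ‖kernel H u ξ - kernel H v ξ‖ₑ ^ 2).toReal := by
  have h := (hA.2 u).eLpNorm_sub hA.1 (measurable_kernel hH u).aestronglyMeasurable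
    (measurable_kernel hH v).aestronglyMeasurable (hA.2 v)
  have hm := ((hA.2 u).memLp_two hA.1).sub ((hA.2 v).memLp_two hA.1)
  have h1 := hm.toReal_eLpNorm_two_sq
  rw [h, ← ENNReal.toReal_pow] at h1
  have h2 : eLpNorm (kernel H u - kernel H v) 2 volume ^ 2 =
      ∫⁻ ξ, ‖kernel H u ξ - kernel H v ξ‖ₑ ^ 2 := by
    have := eLpNorm_nnreal_pow_eq_lintegral (f := kernel H u - kernel H v)
      (μ := (volume : Measure (EuclideanSpace ℝ (Fin d)))) (p := 2) (by norm_num)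
    simpa using this
  rw [← h2, h1]
  congr 1; ext x
  simp only [Pi.sub_apply]
  rw [← Complex.ofReal_sub, Complex.norm_real, Real.norm_eq_abs, sq_abs]

end

end AFBM

/-! ### The variogram in polar coordinates. -/

/-- Positivity of `c` makes a separate integrability hypothesis superfluous: the Bochner integral of
a nonintegrable function is `0`. -/
theorem setLIntegral_ofReal_eq {α : Type*} [MeasurableSpace α] {μ : Measure α} {s : Set α}
    (hs : MeasurableSet s) {f : α → ℝ} {c : ℝ} (hf : ∀ x ∈ s, 0 ≤ f x) (hc : 0 < c)
    (h : ∫ x in s, f x ∂μ = c) : ∫⁻ x in s, ENNReal.ofReal (f x) ∂μ = ENNReal.ofReal c := by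
  have hi : Integrable f (μ.restrict s) := by
    by_contra hn
    rw [integral_undef hn] at h
    exact hc.ne h
  rw [← h, ofReal_integral_eq_lintegral_ofReal hi ((ae_restrict_iff' hs).2 (ae_of_all _ hf))]

theorem integral_one_sub_cos_mul_exp_neg {a y : ℝ} (hy : 0 < y) :
    ∫ ρ in Set.Ioi (0 : ℝ), (1 - Real.cos (a * ρ)) * Real.exp (-(ρ * y)) =
      a ^ 2 / (y * (y ^ 2 + a ^ 2)) := by
  have hre : (-(y : ℂ) + a * Complex.I).re < 0 := by simpa using hy
  have hre' : (-(y : ℂ)).re < 0 := by simpa using hy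
  have i1 := integrableOn_exp_mul_complex_Ioi hre 0
  have i2 := integrableOn_exp_mul_complex_Ioi hre' 0
  have h := integral_sub i2 i1
  rw [integral_exp_mul_complex_Ioi hre, integral_exp_mul_complex_Ioi hre'] at h
  have h2 := integral_re (i2.sub i1)
  have e : ∀ ρ : ℝ, (1 - Real.cos (a * ρ)) * Real.exp (-(ρ * y)) =
      RCLike.re (((fun x : ℝ => Complex.exp (-(y : ℂ) * x)) -
        fun x : ℝ => Complex.exp ((-(y : ℂ) + a * Complex.I) * x)) ρ) := by
    intro ρ
    simp only [Pi.sub_apply, map_sub, RCLike.re_to_complex, Complex.exp_re]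
    simp
    ring_nf
  simp only [e]
  rw [h2]
  simp only [Pi.sub_apply]
  rw [h]
  have hy2 : y ^ 2 + a ^ 2 ≠ 0 := by positivity
  simp [Complex.div_re, Complex.normSq_apply]
  field_simp
  ring

/-- The spectral integral of fractional Brownian motion. -/
theorem lintegral_one_sub_cos_mul_rpow {h a : ℝ} (h0 : 0 < h) (h1 : h < 1) :
    ∫⁻ ρ in Set.Ioi (0 : ℝ), ENNReal.ofReal (2 * (1 - Real.cos (a * ρ)) * ρ ^ (-2 * h - 1)) =
      ENNReal.ofReal (Real.pi / (Real.sin (Real.pi * h) * Real.Gamma (2 * h + 1)) *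
        |a| ^ (2 * h)) := by
  rcases eq_or_ne a 0 with rfl | ha
  · simp [Real.zero_rpow (by positivity : 2 * h ≠ 0)]
  have hsin : 0 < Real.sin (Real.pi * h) :=
    Real.sin_pos_of_pos_of_lt_pi (by positivity) (by nlinarith [Real.pi_pos])
  have hG1 : 0 < Real.Gamma (2 * h + 1) := Real.Gamma_pos_of_pos (by linarith)
  have hG2 : 0 < Real.Gamma h := Real.Gamma_pos_of_pos h0
  have hG3 : 0 < Real.Gamma (1 - h) := Real.Gamma_pos_of_pos (by linarith)
  have ha2 : 0 < a ^ 2 := by positivity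
  have hcos : ∀ ρ, 0 ≤ 2 * (1 - Real.cos (a * ρ)) := fun ρ => by
    linarith [Real.cos_le_one (a * ρ)]
  set I := ∫⁻ ρ in Set.Ioi (0 : ℝ),
    ENNReal.ofReal (2 * (1 - Real.cos (a * ρ)) * ρ ^ (-2 * h - 1)) with hI
  -- The power `ρ^(-2h-1)` is written as a Gamma integral in `y`, so that the `ρ`-integral becomes
  -- an elementary Laplace transform.
  have s1 : ENNReal.ofReal (Real.Gamma (2 * h + 1)) * I =
      ∫⁻ ρ in Set.Ioi (0 : ℝ), ∫⁻ y in Set.Ioi (0 : ℝ),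
        ENNReal.ofReal (2 * (1 - Real.cos (a * ρ)) * (y ^ (2 * h) * Real.exp (-(ρ * y)))) := by
    rw [hI, ← lintegral_const_mul' _ _ ENNReal.ofReal_ne_top]
    refine setLIntegral_congr_fun measurableSet_Ioi fun ρ hρ => ?_
    have hρ : 0 < ρ := hρ
    have := Real.integral_rpow_mul_exp_neg_mul_Ioi (a := 2 * h + 1) (by linarith) hρ
    rw [add_sub_cancel_right] at this
    simp only [ENNReal.ofReal_mul (hcos ρ)]
    rw [lintegral_const_mul' _ _ ENNReal.ofReal_ne_top, setLIntegral_ofReal_eq measurableSet_Ioi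
      (fun y hy => by have : 0 < y := hy; positivity) (by positivity) this, mul_left_comm,
      ← ENNReal.ofReal_mul hG1.le]
    congr 2
    rw [mul_comm, one_div, Real.inv_rpow hρ.le, ← Real.rpow_neg hρ.le]
    congr 2; ring
  -- Tonelli and the `ρ`-integral leave the factor `1/(y² + a²)`, itself written as the integral of
  -- an exponential in `w`.
  have s2 : ENNReal.ofReal (Real.Gamma (2 * h + 1)) * I =
      ∫⁻ y in Set.Ioi (0 : ℝ), ∫⁻ w in Set.Ioi (0 : ℝ), ENNReal.ofReal
        (2 * a ^ 2 * y ^ (2 * h - 1) * (Real.exp (-((y ^ 2 + a ^ 2) * w)))) := by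
    rw [s1, lintegral_lintegral_swap (by fun_prop)]
    refine setLIntegral_congr_fun measurableSet_Ioi fun y hy => ?_
    have hy : 0 < y := hy
    have e1 : ∀ ρ, ENNReal.ofReal (2 * (1 - Real.cos (a * ρ)) *
        (y ^ (2 * h) * Real.exp (-(ρ * y)))) = ENNReal.ofReal (2 * y ^ (2 * h)) *
          ENNReal.ofReal ((1 - Real.cos (a * ρ)) * Real.exp (-(ρ * y))) := fun ρ => by
      rw [← ENNReal.ofReal_mul (by positivity)]
      congr 1; ring
    have e2 : ∫ w in Set.Ioi (0 : ℝ), Real.exp (-((y ^ 2 + a ^ 2) * w)) = 1 / (y ^ 2 + a ^ 2) := by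
      have := integral_exp_mul_Ioi (a := -(y ^ 2 + a ^ 2)) (by linarith [sq_nonneg y]) 0
      simp only [mul_zero, Real.exp_zero, neg_mul, neg_div_neg_eq] at this
      exact this
    simp only [e1]
    rw [lintegral_const_mul' _ _ ENNReal.ofReal_ne_top,
      setLIntegral_ofReal_eq measurableSet_Ioi (fun ρ _ => mul_nonneg
        (by linarith [Real.cos_le_one (a * ρ)]) (Real.exp_pos _).le) (by positivity)
        (integral_one_sub_cos_mul_exp_neg hy)]
    simp only [ENNReal.ofReal_mul (by positivity : 0 ≤ 2 * a ^ 2 * y ^ (2 * h - 1))]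
    rw [lintegral_const_mul' _ _ ENNReal.ofReal_ne_top,
      setLIntegral_ofReal_eq measurableSet_Ioi (fun w _ => (Real.exp_pos _).le) (by positivity) e2,
      ← ENNReal.ofReal_mul (by positivity), ← ENNReal.ofReal_mul (by positivity)]
    congr 1
    rw [Real.rpow_sub_one hy.ne']
    field_simp
  -- A second use of Tonelli: the `y`-integral yields `Γ(h)` and the remaining `w`-integral yields
  -- `Γ(1-h)`, whose product is given by the reflection formula.
  have s3 : ENNReal.ofReal (Real.Gamma (2 * h + 1)) * I =
      ∫⁻ w in Set.Ioi (0 : ℝ), ENNReal.ofReal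
        (a ^ 2 * Real.Gamma h * (w ^ ((1 - h) - 1) * (Real.exp (-(a ^ 2 * w))))) := by
    rw [s2, lintegral_lintegral_swap (by fun_prop)]
    refine setLIntegral_congr_fun measurableSet_Ioi fun w hw => ?_
    have hw : 0 < w := hw
    have e1 : ∀ y, ENNReal.ofReal (2 * a ^ 2 * y ^ (2 * h - 1) *
        (Real.exp (-((y ^ 2 + a ^ 2) * w)))) = ENNReal.ofReal (2 * a ^ 2 * Real.exp (-(a ^ 2 * w)))
          * ENNReal.ofReal (y ^ (2 * h - 1) * Real.exp (-w * y ^ (2 : ℝ))) := fun y => by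
      rw [← ENNReal.ofReal_mul (by positivity)]
      have : -((y ^ 2 + a ^ 2) * w) = -(a ^ 2 * w) + -w * y ^ (2 : ℝ) := by
        rw [Real.rpow_two]; ring
      rw [this, Real.exp_add]
      congr 1; ring
    simp only [e1]
    have e2 := integral_rpow_mul_exp_neg_mul_rpow (p := 2) (q := 2 * h - 1) (by norm_num)
      (by linarith) hw
    have e3 : (2 * h - 1 + 1) / 2 = h := by ring
    have e4 : -(2 * h - 1 + 1) / 2 = -h := by ring
    rw [e3, e4] at e2
    rw [lintegral_const_mul' _ _ ENNReal.ofReal_ne_top,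
      setLIntegral_ofReal_eq measurableSet_Ioi
        (fun y hy => by have : 0 < y := hy; positivity) (by positivity) e2,
      ← ENNReal.ofReal_mul (by positivity)]
    congr 1
    have e5 : 1 - h - 1 = -h := by ring
    rw [e5]; ring
  have e1 := Real.integral_rpow_mul_exp_neg_mul_Ioi (a := 1 - h) (by linarith) ha2
  simp only [ENNReal.ofReal_mul (by positivity : 0 ≤ a ^ 2 * Real.Gamma h)] at s3
  rw [lintegral_const_mul' _ _ ENNReal.ofReal_ne_top, setLIntegral_ofReal_eq measurableSet_Ioi
        (fun y hy => by have : 0 < y := hy; positivity) (by positivity) e1,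
        ← ENNReal.ofReal_mul (by positivity)] at s3
  have e2 : a ^ 2 * Real.Gamma h * ((1 / a ^ 2) ^ (1 - h) * Real.Gamma (1 - h)) =
      Real.Gamma (2 * h + 1) * (Real.pi / (Real.sin (Real.pi * h) * Real.Gamma (2 * h + 1)) *
        |a| ^ (2 * h)) := by
    have r1 := Real.Gamma_mul_Gamma_one_sub h
    have r2 : a ^ 2 * (1 / a ^ 2) ^ (1 - h) = |a| ^ (2 * h) := by
      rw [one_div, Real.inv_rpow ha2.le, ← Real.rpow_neg ha2.le]
      nth_rw 1 [← Real.rpow_one (a ^ 2)]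
      rw [← Real.rpow_add ha2, ← sq_abs, ← Real.rpow_natCast, ← Real.rpow_mul (abs_nonneg a)]
      congr 1; push_cast; ring
    calc _ = (a ^ 2 * (1 / a ^ 2) ^ (1 - h)) * (Real.Gamma h * Real.Gamma (1 - h)) := by ring
      _ = _ := by rw [r1, r2]; field_simp
  rw [e2, ENNReal.ofReal_mul hG1.le] at s3
  exact (ENNReal.mul_right_inj (by simpa using hG1) ENNReal.ofReal_ne_top).1 s3

/-- Integration in polar coordinates in `ℝ²`. -/
theorem EuclideanSpace.lintegral_polarCoord {f : EuclideanSpace ℝ (Fin 2) → ℝ≥0∞}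
    (hf : Measurable f) :
    ∫⁻ ξ, f ξ = ∫⁻ θ in Set.Ioo (-Real.pi) Real.pi, ∫⁻ ρ in Set.Ioi (0 : ℝ),
      ENNReal.ofReal ρ * f !₂[ρ * Real.cos θ, ρ * Real.sin θ] := by
  have hg : Measurable fun p : ℝ × ℝ => f !₂[p.1, p.2] := by fun_prop
  have h1 : ∫⁻ ξ, f ξ = ∫⁻ p : ℝ × ℝ, f !₂[p.1, p.2] := by
    rw [← (volume_preserving_finTwoArrow ℝ).lintegral_comp hg,
      ← (PiLp.volume_preserving_ofLp (Fin 2)).lintegral_comp (by fun_prop)]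
    congr 1; ext ξ
    congr 1; ext i
    fin_cases i <;> simp [MeasurableEquiv.finTwoArrow]
  rw [h1, ← lintegral_comp_polarCoord_symm, polarCoord_target, Measure.volume_eq_prod,
    setLIntegral_prod_symm]
  · simp only [polarCoord_symm_apply, smul_eq_mul]
  · simp only [polarCoord_symm_apply, smul_eq_mul]
    fun_prop

namespace AFBM

variable {H : EuclideanSpace ℝ (Fin 2) → ℝ}

theorem IsDirectionalHurst.angular_mem_Ioo (hH : IsDirectionalHurst H) (θ : ℝ) :
    angular H θ ∈ Set.Ioo (0 : ℝ) 1 := hH.mem_Ioo _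

theorem IsDirectionalHurst.angular_periodic (hH : IsDirectionalHurst H) :
    Function.Periodic (angular H) Real.pi := fun θ => by
  unfold angular
  rw [← hH.homogeneous !₂[Real.cos θ, Real.sin θ] (-1) (by norm_num)]
  congr 1; ext i
  fin_cases i <;> simp

theorem hurstConst_one_sq {h : ℝ} (h0 : 0 < h) (h1 : h < 1) :
    hurstConst 1 h ^ 2 = Real.pi / (h * Real.Gamma (2 * h) * Real.sin (h * Real.pi)) := by
  have hsin : 0 < Real.sin (h * Real.pi) :=
    Real.sin_pos_of_pos_of_lt_pi (by positivity) (by nlinarith [Real.pi_pos])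
  have hG1 : 0 < Real.Gamma (2 * h) := Real.Gamma_pos_of_pos (by linarith)
  have hG2 : 0 < Real.Gamma (h + 1 / 2) := Real.Gamma_pos_of_pos (by linarith)
  unfold hurstConst
  rw [Nat.cast_one, one_add_one_eq_two, div_self (two_ne_zero), Real.rpow_one,
    Real.sq_sqrt (by positivity), mul_div_mul_right _ _ hG2.ne']

theorem spectralWeight_eq (hH : IsDirectionalHurst H) (L ω θ : ℝ) :
    spectralWeight H L ω θ = Real.pi / (angular H θ * Real.Gamma (2 * angular H θ) *
      Real.sin (angular H θ * Real.pi)) / 8 * L ^ (2 * angular H θ) *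
      |Real.cos (θ - ω)| ^ (2 * angular H θ) := by
  rw [spectralWeight, hurstConst_one_sq (hH.angular_mem_Ioo θ).1 (hH.angular_mem_Ioo θ).2]

theorem spectralWeight_nonneg (H : EuclideanSpace ℝ (Fin 2) → ℝ) {L : ℝ} (hL : 0 < L) (ω θ : ℝ) :
    0 ≤ spectralWeight H L ω θ := by
  unfold spectralWeight; positivity

theorem spectralWeight_pos (hH : IsDirectionalHurst H) {L : ℝ} (hL : 0 < L) {ω θ : ℝ}
    (h : Real.cos (θ - ω) ≠ 0) : 0 < spectralWeight H L ω θ := by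
  obtain ⟨h0, h1⟩ := hH.angular_mem_Ioo θ
  rw [spectralWeight_eq hH]
  have hsin : 0 < Real.sin (angular H θ * Real.pi) :=
    Real.sin_pos_of_pos_of_lt_pi (by positivity) (by nlinarith [Real.pi_pos])
  have hG1 : 0 < Real.Gamma (2 * angular H θ) := Real.Gamma_pos_of_pos (by linarith)
  positivity

theorem continuous_spectralWeight (hH : IsDirectionalHurst H) (hc : Continuous (angular H))
    {L : ℝ} (hL : 0 < L) (ω : ℝ) : Continuous (spectralWeight H L ω) := by
  have e : spectralWeight H L ω = fun θ => _ := funext fun θ => spectralWeight_eq hH L ω θ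
  rw [e]
  have hpos : ∀ θ, 0 < angular H θ := fun θ => (hH.angular_mem_Ioo θ).1
  have hG : Continuous fun θ => Real.Gamma (2 * angular H θ) := by
    refine continuous_iff_continuousAt.2 fun θ => ?_
    refine ContinuousAt.comp (f := fun θ => 2 * angular H θ)
      (Real.differentiableAt_Gamma fun m => ?_).continuousAt (by fun_prop)
    have := hpos θ
    have : (0 : ℝ) ≤ m := Nat.cast_nonneg m
    linarith
  refine Continuous.mul (Continuous.mul (Continuous.div_const (Continuous.div continuous_const
    ((hc.mul hG).mul (by fun_prop)) fun θ => ?_) 8) ?_) ?_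
  · have hsin : 0 < Real.sin (angular H θ * Real.pi) :=
      Real.sin_pos_of_pos_of_lt_pi (mul_pos (hpos θ) Real.pi_pos)
        (by nlinarith [Real.pi_pos, (hH.angular_mem_Ioo θ).2])
    have hG1 : 0 < Real.Gamma (2 * angular H θ) := Real.Gamma_pos_of_pos (by linarith [hpos θ])
    exact (mul_pos (mul_pos (hpos θ) hG1) hsin).ne'
  · exact continuous_const.rpow (by fun_prop) fun θ => Or.inl hL.ne'
  · exact Continuous.rpow (by fun_prop) (by fun_prop) fun θ => Or.inr (by linarith [hpos θ])

theorem spectralWeight_periodic (hH : IsDirectionalHurst H) (L ω : ℝ) :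
    Function.Periodic (spectralWeight H L ω) Real.pi := fun θ => by
  unfold spectralWeight
  rw [hH.angular_periodic θ]
  have : θ + Real.pi - ω = θ - ω + Real.pi := by ring
  rw [this, Real.cos_add_pi, abs_neg]

/-- The radial density is `|exp(ip) - exp(iq)|² = 2(1 - cos(p - q))` times the Jacobian `ρ` over
`ρ^(2h+2)`. Only `t - s` survives, whence the stationarity of increments. -/
theorem enorm_kernel_sub_sq_polar (hH : IsDirectionalHurst H) (L ω θ t s : ℝ) {ρ : ℝ}
    (hρ : 0 < ρ) :
    ENNReal.ofReal ρ * ‖kernel H !₂[L * t * Real.cos ω, L * t * Real.sin ω]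
        !₂[ρ * Real.cos θ, ρ * Real.sin θ] -
      kernel H !₂[L * s * Real.cos ω, L * s * Real.sin ω]
        !₂[ρ * Real.cos θ, ρ * Real.sin θ]‖ₑ ^ 2 =
    ENNReal.ofReal (2 * (1 - Real.cos (L * (t - s) * Real.cos (θ - ω) * ρ)) *
      ρ ^ (-2 * angular H θ - 1)) := by
  set ξ : EuclideanSpace ℝ (Fin 2) := !₂[ρ * Real.cos θ, ρ * Real.sin θ] with hξ
  have hnorm : ‖ξ‖ = ρ := by
    rw [hξ, EuclideanSpace.norm_eq]
    simp only [Fin.sum_univ_two, Real.norm_eq_abs, sq_abs]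
    simp only [Matrix.cons_val_zero, Matrix.cons_val_one, mul_pow, ← mul_add,
      Real.cos_sq_add_sin_sq, mul_one]
    exact Real.sqrt_sq hρ.le
  have hHξ : H ξ = angular H θ := by
    rw [angular, ← hH.homogeneous !₂[Real.cos θ, Real.sin θ] ρ hρ.ne', hξ]
    congr 1; ext i
    fin_cases i <;> simp
  have hinner : ∀ r, inner ℝ !₂[L * r * Real.cos ω, L * r * Real.sin ω] ξ =
      L * r * Real.cos (θ - ω) * ρ := fun r => by
    rw [hξ, Real.cos_sub]
    simp [PiLp.inner_apply, Fin.sum_univ_two]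
    ring
  set h := angular H θ with hh
  unfold kernel
  rw [hinner, hinner, hnorm, hHξ, ← sub_div, sub_sub_sub_cancel_right]
  have hexp : ∀ p q : ℝ, ‖Complex.exp (Complex.I * p) - Complex.exp (Complex.I * q)‖ ^ 2 =
      2 * (1 - Real.cos (p - q)) := fun p q => by
    rw [← Complex.normSq_eq_norm_sq, mul_comm, mul_comm Complex.I, Complex.normSq_apply,
      Complex.sub_re, Complex.sub_im, Complex.exp_ofReal_mul_I_re, Complex.exp_ofReal_mul_I_re,
      Complex.exp_ofReal_mul_I_im, Complex.exp_ofReal_mul_I_im, Real.cos_sub]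
    linear_combination Real.sin_sq_add_cos_sq p + Real.sin_sq_add_cos_sq q
  rw [← ofReal_norm, ← ENNReal.ofReal_pow (norm_nonneg _), ← ENNReal.ofReal_mul hρ.le, norm_div,
    div_pow, hexp, Complex.norm_real, Real.norm_of_nonneg (by positivity)]
  congr 1
  have e1 : L * t * Real.cos (θ - ω) * ρ - L * s * Real.cos (θ - ω) * ρ =
      L * (t - s) * Real.cos (θ - ω) * ρ := by ring
  have e2 : ρ ^ (-2 * h - 1) = ρ * ((ρ ^ (h + ((2 : ℕ) : ℝ) / 2)) ^ 2)⁻¹ := by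
    rw [← Real.rpow_natCast, ← Real.rpow_mul hρ.le, ← Real.rpow_neg hρ.le]
    nth_rw 2 [← Real.rpow_one ρ]
    rw [← Real.rpow_add hρ]
    congr 1; push_cast; ring
  rw [e1, e2]
  field_simp

/-- The variogram of the restriction of the field to a radial line. -/
theorem lintegral_enorm_kernel_sub_sq (hH : IsDirectionalHurst H) (hc : Continuous (angular H))
    {L : ℝ} (hL : 0 < L) (ω t s φ : ℝ) :
    (∫⁻ ξ, ‖kernel H !₂[L * t * Real.cos ω, L * t * Real.sin ω] ξ -
      kernel H !₂[L * s * Real.cos ω, L * s * Real.sin ω] ξ‖ₑ ^ 2).toReal =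
    8 * ∫ θ in φ..φ + Real.pi, spectralWeight H L ω θ * |t - s| ^ (2 * angular H θ) := by
  have hm := measurable_kernel hH.measurable
  have hcont : Continuous fun θ => spectralWeight H L ω θ * |t - s| ^ (2 * angular H θ) :=
    (continuous_spectralWeight hH hc hL ω).mul (continuous_const.rpow (by fun_prop)
      fun θ => Or.inr (by linarith [(hH.angular_mem_Ioo θ).1]))
  have hper : Function.Periodic
      (fun θ => spectralWeight H L ω θ * |t - s| ^ (2 * angular H θ)) Real.pi := fun θ => by
    simp only [spectralWeight_periodic hH L ω θ, hH.angular_periodic θ]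
  have hnn : ∀ θ, 0 ≤ spectralWeight H L ω θ * |t - s| ^ (2 * angular H θ) := fun θ =>
    mul_nonneg (spectralWeight_nonneg H hL ω θ) (by positivity)
  rw [EuclideanSpace.lintegral_polarCoord (f := fun ξ =>
    ‖kernel H !₂[L * t * Real.cos ω, L * t * Real.sin ω] ξ -
      kernel H !₂[L * s * Real.cos ω, L * s * Real.sin ω] ξ‖ₑ ^ 2)
    (((hm _).sub (hm _)).enorm.pow_const 2)]
  -- Each direction contributes `4 Λ |t - s|^(2H)`. The full circle covers two periods of length π,
  -- which gives the factor `8` and lets the window start at any `φ`.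
  have h1 : ∀ θ, ∫⁻ ρ in Set.Ioi (0 : ℝ), ENNReal.ofReal ρ *
      ‖kernel H !₂[L * t * Real.cos ω, L * t * Real.sin ω]
        !₂[ρ * Real.cos θ, ρ * Real.sin θ] -
      kernel H !₂[L * s * Real.cos ω, L * s * Real.sin ω]
        !₂[ρ * Real.cos θ, ρ * Real.sin θ]‖ₑ ^ 2 =
      ENNReal.ofReal (4 * (spectralWeight H L ω θ * |t - s| ^ (2 * angular H θ))) := fun θ => by
    obtain ⟨h0, h1⟩ := hH.angular_mem_Ioo θ
    rw [setLIntegral_congr_fun measurableSet_Ioi fun ρ hρ =>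
      enorm_kernel_sub_sq_polar hH L ω θ t s hρ, lintegral_one_sub_cos_mul_rpow h0 h1,
      spectralWeight_eq hH, Real.Gamma_add_one (by positivity), abs_mul, abs_mul, abs_of_pos hL,
      Real.mul_rpow (by positivity) (by positivity), Real.mul_rpow hL.le (by positivity),
      mul_comm Real.pi (angular H θ)]
    congr 1
    have hsin : 0 < Real.sin (angular H θ * Real.pi) :=
      Real.sin_pos_of_pos_of_lt_pi (by positivity) (by nlinarith [Real.pi_pos])
    have hG1 : 0 < Real.Gamma (2 * angular H θ) := Real.Gamma_pos_of_pos (by linarith)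
    field_simp
    ring
  simp only [h1]
  have hpi := Real.pi_pos
  rw [← ofReal_integral_eq_lintegral_ofReal
    (((hcont.const_mul 4).integrableOn_Icc).mono_set Set.Ioo_subset_Icc_self)
    (ae_of_all _ fun θ => mul_nonneg (by norm_num) (hnn θ)),
    ENNReal.toReal_ofReal (integral_nonneg fun θ => mul_nonneg (by norm_num) (hnn θ)),
    ← integral_Ioc_eq_integral_Ioo, ← intervalIntegral.integral_of_le (by linarith),
    intervalIntegral.integral_const_mul,
    ← intervalIntegral.integral_add_adjacent_intervals (b := 0)
      (hcont.intervalIntegrable _ _) (hcont.intervalIntegrable _ _)]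
  have p1 := hper.intervalIntegral_add_eq (-Real.pi) φ
  have p2 := hper.intervalIntegral_add_eq 0 φ
  rw [neg_add_cancel] at p1
  rw [zero_add] at p2
  rw [p1, p2]
  ring

end AFBM

/-! ### Laplace's method. -/

theorem tendsto_sub_div_sq_of_contDiff_two {f : ℝ → ℝ} {x₀ : ℝ} (hf : ContDiff ℝ 2 f)
    (h1 : deriv f x₀ = 0) :
    Tendsto (fun y => (f (x₀ + y) - f x₀) / y ^ 2) (𝓝[≠] 0) (𝓝 (iteratedDeriv 2 f x₀ / 2)) := by
  have h := taylor_isLittleO_univ (x₀ := x₀) (n := 2) hf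
  have e : ∀ x, taylorWithinEval f 2 Set.univ x₀ x =
      f x₀ + iteratedDeriv 2 f x₀ / 2 * (x - x₀) ^ 2 := fun x => by
    rw [taylorWithinEval_succ, taylorWithinEval_succ, taylor_within_zero_eval]
    simp only [iteratedDerivWithin_univ, zero_add, iteratedDeriv_one, h1]
    norm_num
    ring
  simp only [e] at h
  have hshift : Tendsto (fun y => x₀ + y) (𝓝 0) (𝓝 x₀) := by
    have : Continuous fun y : ℝ => x₀ + y := by fun_prop
    simpa using this.tendsto 0
  have h := h.comp_tendsto hshift
  have h2 := (h.tendsto_div_nhds_zero.mono_left (nhdsWithin_le_nhds (s := {0}ᶜ))).add_const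
    (iteratedDeriv 2 f x₀ / 2)
  rw [zero_add] at h2
  refine h2.congr' ?_
  filter_upwards [self_mem_nhdsWithin] with y hy
  have : y ≠ 0 := hy
  simp only [Function.comp_apply, add_sub_cancel_left]
  field_simp
  ring

/-- The quotient `φ y / y²`, extended by `b` at `0`, is continuous and positive on a compact
interval, so its minimum serves as `c`. -/
theorem exists_pos_mul_sq_le {φ : ℝ → ℝ} {r b : ℝ} (hr : 0 ≤ r) (hφ : Continuous φ) (hb : 0 < b)
    (h0 : φ 0 = 0)
    (hpos : ∀ y ∈ Set.Icc (-r) r, y ≠ 0 → 0 < φ y)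
    (hlim : Tendsto (fun y => φ y / y ^ 2) (𝓝[≠] 0) (𝓝 b)) :
    ∃ c > 0, ∀ y ∈ Set.Icc (-r) r, c * y ^ 2 ≤ φ y := by
  set ψ : ℝ → ℝ := Function.update (fun y => φ y / y ^ 2) 0 b with hψ
  have hψ0 : ∀ y, y ≠ 0 → ψ y = φ y / y ^ 2 := fun y hy => Function.update_of_ne hy _ _
  have hcont : Continuous ψ := by
    refine continuous_iff_continuousAt.2 fun y => ?_
    rcases eq_or_ne y 0 with rfl | hy
    · exact continuousAt_update_same.2 hlim
    · rw [hψ, continuousAt_update_of_ne hy]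
      exact hφ.continuousAt.div (by fun_prop) (by positivity)
  obtain ⟨z, hz, hmin⟩ := isCompact_Icc.exists_isMinOn (⟨0, by constructor <;> linarith⟩ :
    (Set.Icc (-r) r).Nonempty) hcont.continuousOn
  refine ⟨ψ z, ?_, fun y hy => ?_⟩
  · rcases eq_or_ne z 0 with rfl | hz0
    · simpa [hψ] using hb
    · rw [hψ0 z hz0]
      have := hpos z hz hz0
      positivity
  · rcases eq_or_ne y 0 with rfl | hy0
    · simp [h0]
    · have : ψ z ≤ ψ y := hmin hy
      rwa [hψ0 y hy0, le_div_iff₀ (by positivity)] at this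

/-- Laplace's method at an interior nondegenerate minimum. -/
theorem tendsto_sqrt_mul_integral_exp_neg {φ g : ℝ → ℝ} {r a : ℝ} (hr : 0 < r)
    (hφ : Continuous φ) (hg : Continuous g) (ha : 0 < a) (h0 : φ 0 = 0)
    (hpos : ∀ y ∈ Set.Icc (-r) r, y ≠ 0 → 0 < φ y)
    (hlim : Tendsto (fun y => φ y / y ^ 2) (𝓝[≠] 0) (𝓝 (a / 2))) :
    Tendsto (fun l : ℝ => √l * ∫ y in (-r)..r, g y * Real.exp (-(2 * l * φ y))) atTop
      (𝓝 (g 0 * √(Real.pi / a))) := by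
  obtain ⟨c, hc, hlow⟩ := exists_pos_mul_sq_le hr.le hφ (half_pos ha) h0 hpos hlim
  obtain ⟨M, hM⟩ := (isCompact_Icc (a := -r) (b := r)).exists_bound_of_continuousOn hg.continuousOn
  -- The substitution `y = x / √l` absorbs the factor `√l`. The integrand then converges pointwise
  -- to a Gaussian and, by the quadratic lower bound on `φ`, is dominated by one.
  set F : ℝ → ℝ → ℝ := fun l x => (Set.Ioc (-r) r).indicator
    (fun y => g y * Real.exp (-(2 * l * φ y))) (x / √l) with hF
  have hM0 : 0 ≤ M := (norm_nonneg _).trans (hM 0 (by constructor <;> linarith))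
  have heq : ∀ l : ℝ, 0 < l →
      ∫ x, F l x = √l * ∫ y in (-r)..r, g y * Real.exp (-(2 * l * φ y)) := fun l hl => by
    rw [intervalIntegral.integral_of_le (by linarith), ← integral_indicator measurableSet_Ioc]
    have := Measure.integral_comp_div ((Set.Ioc (-r) r).indicator
      (fun y => g y * Real.exp (-(2 * l * φ y)))) (√l)
    rw [abs_of_nonneg (Real.sqrt_nonneg l), smul_eq_mul] at this
    exact this
  have hgauss : ∫ x : ℝ, g 0 * Real.exp (-a * x ^ 2) = g 0 * √(Real.pi / a) := by
    rw [integral_const_mul, integral_gaussian]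
  rw [← hgauss]
  have hsq : Tendsto (fun l : ℝ => √l) atTop atTop := Real.tendsto_sqrt_atTop
  have main : Tendsto (fun l : ℝ => ∫ x, F l x) atTop
      (𝓝 (∫ x : ℝ, g 0 * Real.exp (-a * x ^ 2))) := by
    refine tendsto_integral_filter_of_dominated_convergence
      (fun x => M * Real.exp (-(2 * c) * x ^ 2)) ?_ ?_ ?_ ?_
    · refine Eventually.of_forall fun l => Measurable.aestronglyMeasurable ?_
      have : Measurable ((Set.Ioc (-r) r).indicator
          (fun y => g y * Real.exp (-(2 * l * φ y)))) :=
        Measurable.indicator (by fun_prop) measurableSet_Ioc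
      exact this.comp (by fun_prop)
    · filter_upwards [eventually_gt_atTop 0] with l hl
      refine ae_of_all _ fun x => ?_
      simp only [hF]
      by_cases hx : x / √l ∈ Set.Ioc (-r) r
      · rw [Set.indicator_of_mem hx, norm_mul, Real.norm_of_nonneg (Real.exp_pos _).le]
        have hx' := Set.Ioc_subset_Icc_self hx
        refine mul_le_mul (hM _ hx') (Real.exp_le_exp.2 ?_) (Real.exp_pos _).le hM0
        have := hlow _ hx'
        rw [div_pow, Real.sq_sqrt hl.le, ← mul_div_assoc, div_le_iff₀ hl] at this
        linarith
      · rw [Set.indicator_of_notMem hx, norm_zero]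
        positivity
    · exact (integrable_exp_neg_mul_sq (by positivity)).const_mul _
    · refine ae_of_all _ fun x => ?_
      have hdiv : Tendsto (fun l : ℝ => x / √l) atTop (𝓝 0) := tendsto_const_nhds.div_atTop hsq
      have hmem : ∀ᶠ l : ℝ in atTop, x / √l ∈ Set.Ioc (-r) r :=
        hdiv (Ioc_mem_nhds (by linarith) hr)
      have hlφ : Tendsto (fun l : ℝ => 2 * l * φ (x / √l)) atTop (𝓝 (a * x ^ 2)) := by
        rcases eq_or_ne x 0 with rfl | hx
        · simp [h0]
        have hne : Tendsto (fun l : ℝ => x / √l) atTop (𝓝[≠] 0) := by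
          refine tendsto_nhdsWithin_iff.2 ⟨hdiv, ?_⟩
          filter_upwards [eventually_gt_atTop 0] with l hl
          exact div_ne_zero hx (Real.sqrt_pos.2 hl).ne'
        have := (hlim.comp hne).mul_const (2 * x ^ 2)
        have e : a / 2 * (2 * x ^ 2) = a * x ^ 2 := by ring
        rw [e] at this
        refine this.congr' ?_
        filter_upwards [eventually_gt_atTop 0] with l hl
        simp only [Function.comp_apply, div_pow, Real.sq_sqrt hl.le]
        field_simp
      have := ((hg.tendsto 0).comp hdiv).mul ((Real.continuous_exp.tendsto _).comp hlφ.neg)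
      rw [← neg_mul] at this
      refine this.congr' ?_
      filter_upwards [hmem] with l hl
      simp only [hF, Set.indicator_of_mem hl, Function.comp_apply]
  refine main.congr' ?_
  filter_upwards [eventually_gt_atTop 0] with l hl using heq l hl

/-! ### Decay of fourth differences of powers. -/

theorem abs_sub_le_of_hasDerivAt {g g' : ℝ → ℝ} {x C : ℝ}
    (hg : ∀ y ∈ Set.Icc x (x + 1), HasDerivAt g (g' y) y)
    (hC : ∀ y ∈ Set.Icc x (x + 1), |g' y| ≤ C) : |g (x + 1) - g x| ≤ C := by
  have := (convex_Icc x (x + 1)).norm_image_sub_le_of_norm_hasDerivWithin_le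
    (fun y hy => (hg y hy).hasDerivWithinAt) hC (Set.left_mem_Icc.2 (by linarith))
    (Set.right_mem_Icc.2 (by linarith))
  simpa using this

theorem abs_rpow_diff_le {x q : ℝ} (hx : 0 < x) (hq : q ≤ 1) :
    |(x + 1) ^ q - x ^ q| ≤ |q| * x ^ (q - 1) := by
  refine abs_sub_le_of_hasDerivAt (g := fun y => y ^ q) (g' := fun y => q * y ^ (q - 1))
    (fun y hy => Real.hasDerivAt_rpow_const (Or.inl (hx.trans_le hy.1).ne')) fun y hy => ?_
  have hy0 := hx.trans_le hy.1
  rw [abs_mul, abs_of_pos (Real.rpow_pos_of_pos hy0 _)]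
  exact mul_le_mul_of_nonneg_left (Real.rpow_le_rpow_of_nonpos hx hy.1 (by linarith))
    (abs_nonneg q)

theorem hasDerivAt_add_rpow {y c q : ℝ} (hy : 0 < y + c) :
    HasDerivAt (fun y => (y + c) ^ q) (q * (y + c) ^ (q - 1)) y := by
  simpa using ((hasDerivAt_id y).add_const c).rpow_const (p := q) (Or.inl hy.ne')

theorem abs_rpow_diff_two_le {x q : ℝ} (hx : 0 < x) (hq : q ≤ 2) :
    |(x + 2) ^ q - 2 * (x + 1) ^ q + x ^ q| ≤ |q| * |q - 1| * x ^ (q - 2) := by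
  have h := abs_sub_le_of_hasDerivAt (g := fun y => (y + 1) ^ q - y ^ q)
    (g' := fun y => q * (y + 1) ^ (q - 1) - q * y ^ (q - 1)) (x := x)
    (C := |q| * |q - 1| * x ^ (q - 2)) (fun y hy => ?_) fun y hy => ?_
  · refine le_of_eq_of_le ?_ h
    have : x + 1 + 1 = x + 2 := by ring
    simp only [this]
    congr 1; ring
  · have hy0 := hx.trans_le hy.1
    exact (hasDerivAt_add_rpow (by linarith)).sub (Real.hasDerivAt_rpow_const (Or.inl hy0.ne'))
  · have hy0 := hx.trans_le hy.1
    have h1 := abs_rpow_diff_le (q := q - 1) hy0 (by linarith)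
    rw [← mul_sub, abs_mul, mul_assoc]
    refine mul_le_mul_of_nonneg_left (h1.trans ?_) (abs_nonneg q)
    refine mul_le_mul_of_nonneg_left ?_ (abs_nonneg _)
    have : q - 1 - 1 = q - 2 := by ring
    rw [this]
    exact Real.rpow_le_rpow_of_nonpos hx hy.1 (by linarith)

/-- Each difference costs one application of the mean value inequality to the difference of lower
order, whose derivative has the same shape with exponent `q - 1`. -/
theorem abs_rpow_diff_three_le {x q : ℝ} (hx : 0 < x) (hq : q ≤ 3) :
    |(x + 3) ^ q - 3 * (x + 2) ^ q + 3 * (x + 1) ^ q - x ^ q| ≤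
      |q| * |q - 1| * |q - 2| * x ^ (q - 3) := by
  have h := abs_sub_le_of_hasDerivAt (g := fun y => (y + 2) ^ q - 2 * (y + 1) ^ q + y ^ q)
    (g' := fun y => q * (y + 2) ^ (q - 1) - 2 * (q * (y + 1) ^ (q - 1)) + q * y ^ (q - 1)) (x := x)
    (C := |q| * |q - 1| * |q - 2| * x ^ (q - 3)) (fun y hy => ?_) fun y hy => ?_
  · refine le_of_eq_of_le ?_ h
    have e1 : x + 1 + 1 = x + 2 := by ring
    have e2 : x + 1 + 2 = x + 3 := by ring
    simp only [e1, e2]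
    congr 1; ring
  · have hy0 := hx.trans_le hy.1
    exact ((hasDerivAt_add_rpow (by linarith)).sub
      ((hasDerivAt_add_rpow (by linarith)).const_mul 2)).add
        (Real.hasDerivAt_rpow_const (Or.inl hy0.ne'))
  · have hy0 := hx.trans_le hy.1
    have h1 := abs_rpow_diff_two_le (q := q - 1) hy0 (by linarith)
    have e : q * (y + 2) ^ (q - 1) - 2 * (q * (y + 1) ^ (q - 1)) + q * y ^ (q - 1) =
      q * ((y + 2) ^ (q - 1) - 2 * (y + 1) ^ (q - 1) + y ^ (q - 1)) := by ring
    have e2 : q - 1 - 1 = q - 2 := by ring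
    have e3 : q - 1 - 2 = q - 3 := by ring
    rw [e2, e3] at h1
    rw [e, abs_mul, mul_assoc, mul_assoc]
    refine mul_le_mul_of_nonneg_left (h1.trans ?_) (abs_nonneg q)
    rw [mul_assoc]
    refine mul_le_mul_of_nonneg_left ?_ (abs_nonneg _)
    refine mul_le_mul_of_nonneg_left ?_ (abs_nonneg _)
    exact Real.rpow_le_rpow_of_nonpos hx hy.1 (by linarith)

/-- The centered fourth-order difference of `x ↦ |x| ^ p`. -/
noncomputable def fourthDiff (p x : ℝ) : ℝ :=
  |x + 2| ^ p - 4 * |x + 1| ^ p + 6 * |x| ^ p - 4 * |x - 1| ^ p + |x - 2| ^ p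

theorem fourthDiff_neg (p x : ℝ) : fourthDiff p (-x) = fourthDiff p x := by
  have e1 : |-x + 2| = |x - 2| := by rw [← abs_neg]; congr 1; ring
  have e2 : |-x + 1| = |x - 1| := by rw [← abs_neg]; congr 1; ring
  have e3 : |-x - 1| = |x + 1| := by rw [← abs_neg]; congr 1; ring
  have e4 : |-x - 2| = |x + 2| := by rw [← abs_neg]; congr 1; ring
  rw [fourthDiff, fourthDiff, e1, e2, e3, e4, abs_neg]
  ring

/-- A fourth difference is a difference of two third differences, each of order `x^(p-3) ≤ x^(-1)`
because `p < 2`. No finer cancellation is needed, since `1/x` is square summable. The gap between 2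
and 3 contains no integer and keeps the base points at least 1; the constant 1000 is generous in
both ranges. -/
theorem abs_fourthDiff_le_of_nonneg {p x : ℝ} (hp0 : 0 < p) (hp : p < 2) (hx : 0 ≤ x)
    (hx' : x ≤ 2 ∨ 3 ≤ x) : |fourthDiff p x| ≤ 1000 / (1 + x) := by
  rcases hx' with h2 | h3
  · have hb : ∀ y : ℝ, |y| ≤ 4 → 0 ≤ |y| ^ p ∧ |y| ^ p ≤ 16 := fun y hy => by
      refine ⟨by positivity, (Real.rpow_le_rpow (abs_nonneg y) hy hp0.le).trans ?_⟩
      refine (Real.rpow_le_rpow_of_exponent_le (by norm_num) hp.le).trans ?_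
      norm_num
    obtain ⟨a1, b1⟩ := hb (x + 2) (by rw [abs_le]; constructor <;> linarith)
    obtain ⟨a2, b2⟩ := hb (x + 1) (by rw [abs_le]; constructor <;> linarith)
    obtain ⟨a3, b3⟩ := hb x (by rw [abs_le]; constructor <;> linarith)
    obtain ⟨a4, b4⟩ := hb (x - 1) (by rw [abs_le]; constructor <;> linarith)
    obtain ⟨a5, b5⟩ := hb (x - 2) (by rw [abs_le]; constructor <;> linarith)
    have h1 : (300 : ℝ) ≤ 1000 / (1 + x) := by
      rw [le_div_iff₀ (by linarith)]; linarith
    refine le_trans ?_ h1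
    rw [fourthDiff, abs_le]
    constructor <;> linarith
  · have key : ∀ y : ℝ, x - 2 ≤ y →
        |(y + 3) ^ p - 3 * (y + 2) ^ p + 3 * (y + 1) ^ p - y ^ p| ≤ 8 * (x - 2)⁻¹ := by
      intro y hy
      have hy1 : 1 ≤ y := by linarith
      refine (abs_rpow_diff_three_le (by linarith) (by linarith)).trans ?_
      have c1 : |p| ≤ 2 := by rw [abs_le]; constructor <;> linarith
      have c2 : |p - 1| ≤ 2 := by rw [abs_le]; constructor <;> linarith
      have c3 : |p - 2| ≤ 2 := by rw [abs_le]; constructor <;> linarith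
      have c4 : y ^ (p - 3) ≤ (x - 2)⁻¹ := by
        refine (Real.rpow_le_rpow_of_exponent_le hy1 (by linarith : p - 3 ≤ -1)).trans ?_
        rw [Real.rpow_neg_one]
        exact inv_anti₀ (by linarith) hy
      calc |p| * |p - 1| * |p - 2| * y ^ (p - 3) ≤ 2 * 2 * 2 * (x - 2)⁻¹ := by gcongr
        _ = _ := by ring
    have k1 := key (x - 2) le_rfl
    have k2 := key (x - 1) (by linarith)
    have e : fourthDiff p x =
        ((x - 1 + 3) ^ p - 3 * (x - 1 + 2) ^ p + 3 * (x - 1 + 1) ^ p - (x - 1) ^ p) -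
        ((x - 2 + 3) ^ p - 3 * (x - 2 + 2) ^ p + 3 * (x - 2 + 1) ^ p - (x - 2) ^ p) := by
      have e1 : x - 1 + 3 = x + 2 := by ring
      have e2 : x - 1 + 2 = x + 1 := by ring
      have e3 : x - 1 + 1 = x := by ring
      have e4 : x - 2 + 3 = x + 1 := by ring
      have e5 : x - 2 + 2 = x := by ring
      have e6 : x - 2 + 1 = x - 1 := by ring
      rw [e1, e2, e3, e4, e5, e6, fourthDiff, abs_of_nonneg (by linarith : 0 ≤ x + 2),
        abs_of_nonneg (by linarith : 0 ≤ x + 1), abs_of_nonneg hx,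
        abs_of_nonneg (by linarith : 0 ≤ x - 1), abs_of_nonneg (by linarith : 0 ≤ x - 2)]
      ring
    rw [e]
    refine (abs_sub _ _).trans ((add_le_add k2 k1).trans ?_)
    rw [← add_mul, ← div_eq_mul_inv, div_le_div_iff₀ (by linarith) (by linarith)]
    linarith

theorem abs_fourthDiff_intCast_le {p : ℝ} (hp0 : 0 < p) (hp : p < 2) (j : ℤ) :
    |fourthDiff p j| ≤ 1000 / (1 + |(j : ℝ)|) := by
  have aux : ∀ m : ℕ, |fourthDiff p m| ≤ 1000 / (1 + (m : ℝ)) := fun m => by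
    refine abs_fourthDiff_le_of_nonneg hp0 hp (Nat.cast_nonneg m) ?_
    rcases Nat.lt_or_ge m 3 with h | h
    · exact Or.inl (by exact_mod_cast Nat.lt_succ_iff.1 h)
    · exact Or.inr (by exact_mod_cast h)
  obtain ⟨m, rfl | rfl⟩ := j.eq_nat_or_neg
  · simpa using aux m
  · simpa [fourthDiff_neg] using aux m

theorem summable_one_div_one_add_abs_sq :
    Summable fun j : ℤ => (1 / (1 + |(j : ℝ)|)) ^ 2 := by
  have h : Summable fun n : ℕ => (1 / (1 + (n : ℝ))) ^ 2 := by
    have := (summable_nat_add_iff 1).2 (Real.summable_one_div_nat_pow (p := 2) |>.2 one_lt_two)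
    refine this.congr fun n => ?_
    rw [div_pow, one_pow]; push_cast; rw [add_comm]
  refine Summable.of_nat_of_neg ?_ ?_
  · simpa using h
  · simpa using h

/-- Each row sum is part of one convergent series over `ℤ`, so the double sum grows linearly rather
than quadratically in `n`. -/
theorem exists_sum_sum_one_div_le : ∃ C : ℝ, 0 < C ∧ ∀ n : ℕ,
    ∑ k : Finset.Ico 1 n, ∑ l : Finset.Ico 1 n,
      (1 / (1 + |(((k : ℕ) : ℤ) - ((l : ℕ) : ℤ) : ℤ)|) : ℝ) ^ 2 ≤ C * n := by
  refine ⟨∑' j : ℤ, (1 / (1 + |(j : ℝ)|)) ^ 2,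
    summable_one_div_one_add_abs_sq.tsum_pos (fun j => by positivity) 0 (by simp), fun n => ?_⟩
  have hrow : ∀ k : Finset.Ico 1 n, ∑ l : Finset.Ico 1 n,
      (1 / (1 + |(((k : ℕ) : ℤ) - ((l : ℕ) : ℤ) : ℤ)|) : ℝ) ^ 2 ≤
      ∑' j : ℤ, (1 / (1 + |(j : ℝ)|)) ^ 2 := fun k => by
    have hinj : Function.Injective fun l : Finset.Ico 1 n => (((k : ℕ) : ℤ) - ((l : ℕ) : ℤ) : ℤ) :=
      fun l l' h => Subtype.ext (by simpa using h)
    have := summable_one_div_one_add_abs_sq.sum_le_tsum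
      (Finset.univ.map ⟨_, hinj⟩) (fun j _ => by positivity)
    rw [Finset.sum_map] at this
    simpa using this
  refine (Finset.sum_le_sum fun k _ => hrow k).trans ?_
  rw [Finset.sum_const, nsmul_eq_mul, mul_comm]
  have h0 : 0 ≤ ∑' j : ℤ, (1 / (1 + |(j : ℝ)|)) ^ 2 := tsum_nonneg fun j => by positivity
  refine mul_le_mul_of_nonneg_left ?_ h0
  simp

theorem summable_exp_neg_mul_rpow {c s : ℝ} (hc : 0 < c) (hs : 0 < s) :
    Summable fun n : ℕ => Real.exp (-c * (n : ℝ) ^ s) := by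
  have h := (isLittleO_exp_neg_mul_rpow_atTop hc (-2 / s)).comp_tendsto
    ((tendsto_rpow_atTop hs).comp tendsto_natCast_atTop_atTop)
  refine summable_of_isBigO_nat (Real.summable_one_div_nat_pow (p := 2) |>.2 one_lt_two)
    (h.isBigO.congr_right fun n => ?_)
  simp only [Function.comp_apply]
  rw [← Real.rpow_mul (Nat.cast_nonneg n), mul_div_cancel₀ _ hs.ne',
    Real.rpow_neg (Nat.cast_nonneg n), one_div]
  norm_num

/-! ### Mean and covariance of the second-order increments. -/

namespace AFBM

variable {H : EuclideanSpace ℝ (Fin 2) → ℝ}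

/-- By periodicity the strict minimum can be read on a window centred at `θs`, where it is interior
even if `θs = 0`. An angle of the window congruent to `θs` modulo π must be `θs` itself. -/
theorem IsDirectionalHurst.angular_lt (hH : IsDirectionalHurst H) {θs m : ℝ}
    (hmin : ∀ θ ∈ Set.Ico 0 Real.pi, θ ≠ θs → m < angular H θ)
    {y : ℝ} (hy : y ∈ Set.Icc (-(Real.pi / 2)) (Real.pi / 2)) (hy0 : y ≠ 0) :
    m < angular H (θs + y) := by
  have hpi := Real.pi_pos
  have hmem := toIcoMod_mem_Ico Real.pi_pos 0 (θs + y)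
  have hdiv := self_sub_toIcoDiv_zsmul Real.pi_pos 0 (θs + y)
  rw [zero_add] at hmem
  have hval : angular H (toIcoMod Real.pi_pos 0 (θs + y)) = angular H (θs + y) := by
    rw [← hdiv]; exact hH.angular_periodic.sub_zsmul_eq _
  rw [← hval]
  refine hmin _ hmem fun h => hy0 ?_
  rw [h, zsmul_eq_mul] at hdiv
  have hk : y = toIcoDiv Real.pi_pos 0 (θs + y) * Real.pi := by linarith
  generalize toIcoDiv Real.pi_pos 0 (θs + y) = k at hk
  have h1 : (k : ℝ) < 1 := by nlinarith [hy.2]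
  have h2 : (-1 : ℝ) < k := by nlinarith [hy.1]
  have h3 : k < 1 := by exact_mod_cast h1
  have h4 : -1 < k := by exact_mod_cast h2
  have h5 : k = 0 := by omega
  rw [hk, h5]; simp

theorem tendsto_rpow_mul_integral_rpow (hH : IsDirectionalHurst H)
    (hsmooth : ContDiff ℝ 2 (angular H)) {θs : ℝ}
    (hmin : ∀ θ ∈ Set.Ico 0 Real.pi, θ ≠ θs → angular H θs < angular H θ)
    (hnondeg : 0 < iteratedDeriv 2 (angular H) θs) {g : ℝ → ℝ} (hg : Continuous g) :
    Tendsto (fun n : ℕ => (n : ℝ) ^ (2 * angular H θs) * √(Real.log n) *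
      ∫ θ in (θs - Real.pi / 2)..(θs - Real.pi / 2 + Real.pi),
        g θ * (n : ℝ) ^ (-(2 * angular H θ))) atTop
      (𝓝 (g θs * √(Real.pi / iteratedDeriv 2 (angular H) θs))) := by
  have hpi := Real.pi_pos
  have hlt := fun {y : ℝ} => hH.angular_lt hmin (y := y)
  have hloc : IsLocalMin (angular H) θs := by
    filter_upwards [Icc_mem_nhds (by linarith : θs - Real.pi / 2 < θs)
      (by linarith : θs < θs + Real.pi / 2)] with θ hθ
    rcases eq_or_ne θ θs with rfl | hne
    · exact le_rfl
    · have := hlt (y := θ - θs) (by constructor <;> linarith [hθ.1, hθ.2]) (sub_ne_zero.2 hne)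
      rw [add_sub_cancel] at this
      exact this.le
  have hc : Continuous (angular H) := hsmooth.continuous
  have h := tendsto_sqrt_mul_integral_exp_neg (φ := fun y => angular H (θs + y) - angular H θs)
    (g := fun y => g (θs + y)) (r := Real.pi / 2) (by positivity) (by fun_prop) (by fun_prop)
    hnondeg (by simp) (fun y hy hy0 => sub_pos.2 (hlt hy hy0))
    (tendsto_sub_div_sq_of_contDiff_two hsmooth hloc.deriv_eq_zero)
  -- Laplace's method is applied with parameter `log n`, since `n^(-2(H - H(θs))) = exp(-2 log n (H
  -- - H(θs)))`.
  have h2 := h.comp (Real.tendsto_log_atTop.comp tendsto_natCast_atTop_atTop)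
  rw [add_zero] at h2
  refine h2.congr' ?_
  filter_upwards [eventually_gt_atTop 0] with n hn
  have hn0 : (0 : ℝ) < n := by exact_mod_cast hn
  simp only [Function.comp_apply]
  have e := intervalIntegral.integral_comp_add_left (a := -(Real.pi / 2)) (b := Real.pi / 2)
    (fun θ => g θ * (n : ℝ) ^ (-(2 * angular H θ))) θs
  have e2 : θs - Real.pi / 2 + Real.pi = θs + Real.pi / 2 := by ring
  rw [e2, sub_eq_add_neg, ← e, mul_comm ((n : ℝ) ^ _), mul_assoc]
  congr 1
  rw [← intervalIntegral.integral_const_mul]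
  refine intervalIntegral.integral_congr fun y _ => ?_
  rw [mul_left_comm, ← Real.rpow_add hn0, Real.rpow_def_of_pos hn0]
  congr 2; ring

section

variable {Ω : Type*} [MeasurableSpace Ω] {P : Measure Ω}
  {W : Set (EuclideanSpace ℝ (Fin 2)) → Ω → ℂ} {A : EuclideanSpace ℝ (Fin 2) → Ω → ℝ}

theorem IsAFBM.integral_radial_sub_sq (hA : IsAFBM P W H A) (hH : IsDirectionalHurst H)
    (hc : Continuous (angular H)) {L : ℝ} (hL : 0 < L) (ε ω t s φ : ℝ) :
    ∫ x, (radial A L ε ω t x - radial A L ε ω s x) ^ 2 ∂P =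
      8 * ∫ θ in φ..φ + Real.pi, spectralWeight H L ω θ * |t - s| ^ (2 * angular H θ) := by
  have h := hA.integral_sub_sq hH.measurable
    !₂[L * (t + ε) * Real.cos ω, L * (t + ε) * Real.sin ω]
    !₂[L * (s + ε) * Real.cos ω, L * (s + ε) * Real.sin ω]
  rw [lintegral_enorm_kernel_sub_sq hH hc hL ω (t + ε) (s + ε) φ, add_sub_add_right_eq_sub] at h
  exact h

/-- The second-order increment of `X` at `k / n` with mesh `1 / n`. -/
noncomputable def secondDiff (X : ℝ → Ω → ℝ) (n k : ℕ) (x : Ω) : ℝ :=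
  X (((k : ℝ) + 1) / n) x + X (((k : ℝ) - 1) / n) x - 2 * X ((k : ℝ) / n) x

theorem IsAFBM.memLp_radial (hA : IsAFBM P W H A) (L ε ω t : ℝ) :
    MemLp (radial A L ε ω t) 2 P := hA.memLp_two _

theorem IsAFBM.integral_secondDiff_mul (hA : IsAFBM P W H A) (hH : IsDirectionalHurst H)
    (hc : Continuous (angular H)) {L : ℝ} (hL : 0 < L) (ε ω φ : ℝ) {n : ℕ} (hn : 0 < n)
    (k l : ℕ) :
    ∫ x, secondDiff (radial A L ε ω) n k x * secondDiff (radial A L ε ω) n l x ∂P =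
      ∫ θ in φ..φ + Real.pi, 8 * spectralWeight H L ω θ *
        (-(1 / 2) * fourthDiff (2 * angular H θ) (((k : ℤ) - (l : ℤ) : ℤ) : ℝ)) *
          (n : ℝ) ^ (-(2 * angular H θ)) := by
  set Z := radial A L ε ω with hZ
  have hn0 : (0 : ℝ) < n := by exact_mod_cast hn
  set j : ℝ := (((k : ℤ) - (l : ℤ) : ℤ) : ℝ) with hj
  have hjkl : (k : ℝ) - l = j := by rw [hj]; push_cast; rfl
  set V : ℝ → ℝ := fun y => 8 * ∫ θ in φ..φ + Real.pi,
    spectralWeight H L ω θ * |y / n| ^ (2 * angular H θ) with hV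
  have hint : ∀ t s, Integrable (fun x => (Z t x - Z s x) ^ 2) P := fun t s =>
    ((hA.memLp_radial L ε ω t).sub (hA.memLp_radial L ε ω s)).integrable_sq
  have hI : ∀ a b c : ℝ, a - b = c → ∫ x, (Z (a / n) x - Z (b / n) x) ^ 2 ∂P = V c := by
    intro a b c h
    rw [hZ, hA.integral_radial_sub_sq hH hc hL ε ω _ _ φ, ← sub_div, h]
  -- Polarization: the weights `1, 1, -2` sum to zero, so the product is `-1/2` times the doubly
  -- weighted sum of squared increments. Only the variogram is then needed, and collecting equal
  -- lags gives its fourth difference.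
  have hsplit : ∀ x, secondDiff Z n k x * secondDiff Z n l x = -(1 / 2) * (
      (Z ((k + 1) / n) x - Z ((l + 1) / n) x) ^ 2 + (Z ((k + 1) / n) x - Z ((l - 1) / n) x) ^ 2
      - 2 * (Z ((k + 1) / n) x - Z (l / n) x) ^ 2 + (Z ((k - 1) / n) x - Z ((l + 1) / n) x) ^ 2
      + (Z ((k - 1) / n) x - Z ((l - 1) / n) x) ^ 2 - 2 * (Z ((k - 1) / n) x - Z (l / n) x) ^ 2
      - 2 * (Z (k / n) x - Z ((l + 1) / n) x) ^ 2 - 2 * (Z (k / n) x - Z ((l - 1) / n) x) ^ 2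
      + 4 * (Z (k / n) x - Z (l / n) x) ^ 2) := fun x => by
    unfold secondDiff; ring
  have hsum : ∫ x, secondDiff Z n k x * secondDiff Z n l x ∂P =
      -(1 / 2) * (V (j + 2) - 4 * V (j + 1) + 6 * V j - 4 * V (j - 1) + V (j - 2)) := by
    simp only [hsplit]
    rw [integral_const_mul, integral_add (by fun_prop) (by fun_prop),
      integral_sub (by fun_prop) (by fun_prop), integral_sub (by fun_prop) (by fun_prop),
      integral_sub (by fun_prop) (by fun_prop), integral_add (by fun_prop) (by fun_prop),
      integral_add (by fun_prop) (by fun_prop), integral_sub (by fun_prop) (by fun_prop),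
      integral_add (by fun_prop) (by fun_prop)]
    simp only [integral_const_mul]
    rw [hI _ _ j (by linarith), hI _ _ (j + 2) (by linarith), hI _ _ (j + 1) (by linarith),
      hI _ _ (j - 2) (by linarith), hI _ _ j (by linarith), hI _ _ (j - 1) (by linarith),
      hI _ _ (j - 1) (by linarith), hI _ _ (j + 1) (by linarith), hI _ _ j (by linarith)]
    ring
  have hVi : ∀ y : ℝ, IntervalIntegrable
      (fun θ => spectralWeight H L ω θ * |y / n| ^ (2 * angular H θ)) volume φ (φ + Real.pi) :=
    fun y => ((continuous_spectralWeight hH hc hL ω).mul (continuous_const.rpow (by fun_prop)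
      fun θ => Or.inr (by linarith [(hH.angular_mem_Ioo θ).1]))).intervalIntegrable _ _
  rw [hsum, hV]
  simp only [← intervalIntegral.integral_const_mul]
  rw [← intervalIntegral.integral_sub ((hVi _).const_mul _) (((hVi _).const_mul _).const_mul _),
    ← intervalIntegral.integral_add
      (((hVi _).const_mul _).sub (((hVi _).const_mul _).const_mul _))
      (((hVi _).const_mul _).const_mul _),
    ← intervalIntegral.integral_sub
      ((((hVi _).const_mul _).sub (((hVi _).const_mul _).const_mul _)).add
      (((hVi _).const_mul _).const_mul _)) (((hVi _).const_mul _).const_mul _),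
    ← intervalIntegral.integral_add
      (((((hVi _).const_mul _).sub (((hVi _).const_mul _).const_mul _)).add
      (((hVi _).const_mul _).const_mul _)).sub (((hVi _).const_mul _).const_mul _))
      ((hVi _).const_mul _), ← intervalIntegral.integral_const_mul]
  congr 1; ext θ
  have hdiv : ∀ y : ℝ, |y / n| ^ (2 * angular H θ) =
      |y| ^ (2 * angular H θ) * (n : ℝ) ^ (-(2 * angular H θ)) := fun y => by
    rw [abs_div, abs_of_pos hn0, Real.div_rpow (abs_nonneg y) hn0.le, Real.rpow_neg hn0.le,
      div_eq_mul_inv]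
  simp only [hdiv, fourthDiff]
  ring

theorem IsAFBM.integral_secondDiff_sq (hA : IsAFBM P W H A) (hH : IsDirectionalHurst H)
    (hc : Continuous (angular H)) {L : ℝ} (hL : 0 < L) (ε ω φ : ℝ) {n : ℕ} (hn : 0 < n)
    (k : ℕ) :
    ∫ x, secondDiff (radial A L ε ω) n k x * secondDiff (radial A L ε ω) n k x ∂P =
      ∫ θ in φ..φ + Real.pi, 8 * spectralWeight H L ω θ * (4 - 2 ^ (2 * angular H θ)) *
          (n : ℝ) ^ (-(2 * angular H θ)) := by
  rw [hA.integral_secondDiff_mul hH hc hL ε ω φ hn]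
  congr 1; ext θ
  have : -(1 / 2) * fourthDiff (2 * angular H θ) (((k : ℤ) - (k : ℤ) : ℤ) : ℝ) =
      4 - 2 ^ (2 * angular H θ) := by
    have h0 : 2 * angular H θ ≠ 0 := by linarith [(hH.angular_mem_Ioo θ).1]
    simp [fourthDiff, Real.zero_rpow h0]
    ring
  rw [this]

theorem IsAFBM.abs_integral_secondDiff_mul_le (hA : IsAFBM P W H A) (hH : IsDirectionalHurst H)
    (hc : Continuous (angular H)) {L : ℝ} (hL : 0 < L) (ε ω φ : ℝ) {n : ℕ} (hn : 0 < n)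
    (k l : ℕ) :
    |∫ x, secondDiff (radial A L ε ω) n k x * secondDiff (radial A L ε ω) n l x ∂P| ≤
      500 * (1 / (1 + |((((k : ℤ) - (l : ℤ) : ℤ)) : ℝ)|)) *
        ∫ θ in φ..φ + Real.pi, 8 * spectralWeight H L ω θ * (n : ℝ) ^ (-(2 * angular H θ)) := by
  have hn0 : (0 : ℝ) < n := by exact_mod_cast hn
  rw [hA.integral_secondDiff_mul hH hc hL ε ω φ hn, ← intervalIntegral.integral_const_mul,
    ← Real.norm_eq_abs]
  refine intervalIntegral.norm_integral_le_of_norm_le (by linarith [Real.pi_pos])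
    (ae_of_all _ fun θ _ => ?_) (Continuous.intervalIntegrable ?_ _ _)
  · obtain ⟨h0, h1⟩ := hH.angular_mem_Ioo θ
    have hb := abs_fourthDiff_intCast_le (p := 2 * angular H θ) (by linarith) (by linarith)
      ((k : ℤ) - (l : ℤ))
    have hw := spectralWeight_nonneg H hL ω θ
    have hr : 0 ≤ (n : ℝ) ^ (-(2 * angular H θ)) := by positivity
    rw [norm_mul, norm_mul (8 * _), norm_mul (-(1 / 2) : ℝ), Real.norm_of_nonneg hr,
      Real.norm_of_nonneg (by positivity : 0 ≤ 8 * spectralWeight H L ω θ), Real.norm_eq_abs,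
      Real.norm_eq_abs, abs_neg, abs_of_pos (by norm_num : (0 : ℝ) < 1 / 2)]
    have : 1 / 2 * |fourthDiff (2 * angular H θ) (((k : ℤ) - (l : ℤ) : ℤ) : ℝ)| ≤
        500 * (1 / (1 + |((((k : ℤ) - (l : ℤ) : ℤ)) : ℝ)|)) := by
      refine (mul_le_mul_of_nonneg_left hb (by norm_num)).trans (le_of_eq ?_)
      ring
    calc _ ≤ 8 * spectralWeight H L ω θ *
          (500 * (1 / (1 + |((((k : ℤ) - (l : ℤ) : ℤ)) : ℝ)|))) *
          (n : ℝ) ^ (-(2 * angular H θ)) := by gcongr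
      _ = _ := by ring
  · have := continuous_spectralWeight hH hc hL ω
    exact continuous_const.mul ((continuous_const.mul this).mul
      (continuous_const.rpow (by fun_prop) fun θ => Or.inl hn0.ne'))

/-- The vector is a linear image of the field at the triples of nodes `k + 1`, `k - 1`, `k`, indexed
by `Fin 3`. -/
theorem IsAFBM.hasGaussianLaw_secondDiff [IsProbabilityMeasure P] (hA : IsAFBM P W H A)
    (L ε ω : ℝ) (n : ℕ) : HasGaussianLaw
      (fun x (k : Finset.Ico 1 n) => secondDiff (radial A L ε ω) n k x) P := by
  have h := hA.hasGaussianLaw (ι := Finset.Ico 1 n × Fin 3) fun p =>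
    !₂[L * (((p.1 : ℝ) + ![1, -1, 0] p.2) / n + ε) * Real.cos ω,
      L * (((p.1 : ℝ) + ![1, -1, 0] p.2) / n + ε) * Real.sin ω]
  have h2 := h.map_fun (ContinuousLinearMap.pi fun k : Finset.Ico 1 n =>
    ContinuousLinearMap.proj (R := ℝ) (φ := fun _ : Finset.Ico 1 n × Fin 3 => ℝ) (k, (0 : Fin 3)) +
      ContinuousLinearMap.proj (k, (1 : Fin 3)) -
      (2 : ℝ) • ContinuousLinearMap.proj (k, (2 : Fin 3)))
  refine h2.congr (ae_of_all _ fun x => ?_)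
  ext k
  simp [secondDiff, radial, sub_eq_add_neg]

theorem IsAFBM.integral_secondDiff [IsProbabilityMeasure P] (hA : IsAFBM P W H A)
    (L ε ω : ℝ) (n k : ℕ) : ∫ x, secondDiff (radial A L ε ω) n k x ∂P = 0 := by
  have hi : ∀ t, Integrable (radial A L ε ω t) P := fun t =>
    (hA.memLp_radial L ε ω t).integrable (by norm_num)
  have h0 : ∀ t, ∫ x, radial A L ε ω t x ∂P = 0 := fun t => hA.integral_eq_zero _
  have h2 : ∀ t s, Integrable (fun x => radial A L ε ω t x + radial A L ε ω s x) P :=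
    fun t s => (hi t).add (hi s)
  simp only [secondDiff]
  rw [integral_sub (h2 _ _) ((hi _).const_mul 2), integral_add (hi _) (hi _),
    integral_const_mul, h0, h0, h0]
  norm_num

end

end AFBM

/-! ### Borel-Cantelli and the conclusion. -/

theorem proposition16 {Ω : Type*} [MeasurableSpace Ω] (P : Measure Ω) [IsProbabilityMeasure P]
    (H : EuclideanSpace ℝ (Fin 2) → ℝ) (hH : AFBM.IsDirectionalHurst H)
    (W : Set (EuclideanSpace ℝ (Fin 2)) → Ω → ℂ)
    (A : EuclideanSpace ℝ (Fin 2) → Ω → ℝ) (hA : AFBM.IsAFBM P W H A)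
    (L ε ω : ℝ) (hL : 0 < L) (hε : 0 ≤ ε) (hω : ω ∈ Set.Ico 0 (2 * Real.pi))
    (hsmooth : ContDiff ℝ 2 (AFBM.angular H))
    (θs : ℝ) (hθs : θs ∈ Set.Ico 0 Real.pi)
    (hval : AFBM.angular H θs = AFBM.lowerHurst H)
    (hmin : ∀ θ ∈ Set.Ico 0 Real.pi, θ ≠ θs → AFBM.lowerHurst H < AFBM.angular H θ)
    (hnondeg : 0 < iteratedDeriv 2 (AFBM.angular H) θs)
    (hangle : ∀ k : ℤ, ω ≠ θs + Real.pi / 2 + k * Real.pi) :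
    ∀ᵐ x ∂P, Tendsto
      (fun n : ℕ => (n : ℝ) ^ (2 * AFBM.lowerHurst H - 1) * Real.sqrt (Real.log n) *
        AFBM.quadVar (AFBM.radial A L ε ω) n x)
      atTop (𝓝 ((4 - (2 : ℝ) ^ (2 * AFBM.lowerHurst H)) * AFBM.limitConst H L ω θs)) := by
  rw [← hval] at hmin ⊢
  set h := AFBM.angular H θs with hh
  have hc : Continuous (AFBM.angular H) := hsmooth.continuous
  have hΛ := AFBM.continuous_spectralWeight hH hc hL ω
  set φ := θs - Real.pi / 2 with hφ
  set D := AFBM.secondDiff (AFBM.radial A L ε ω) with hD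
  set σ : ℕ → ℝ := fun n => ∫ θ in φ..φ + Real.pi, 8 * AFBM.spectralWeight H L ω θ *
    (4 - 2 ^ (2 * AFBM.angular H θ)) * (n : ℝ) ^ (-(2 * AFBM.angular H θ)) with hσ
  set v : ℕ → ℝ := fun n => ∫ θ in φ..φ + Real.pi, 8 * AFBM.spectralWeight H L ω θ *
    (n : ℝ) ^ (-(2 * AFBM.angular H θ)) with hv
  set N : ℕ → ℝ := fun n => (n : ℝ) ^ (2 * h) * √(Real.log n) with hN
  set G := AFBM.limitConst H L ω θs with hG
  have hσlim : Tendsto (fun n => N n * σ n) atTop (𝓝 ((4 - 2 ^ (2 * h)) * G)) := by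
    have := AFBM.tendsto_rpow_mul_integral_rpow hH hsmooth hmin hnondeg
      (g := fun θ => 8 * AFBM.spectralWeight H L ω θ * (4 - 2 ^ (2 * AFBM.angular H θ)))
      ((continuous_const.mul hΛ).mul (continuous_const.sub
        (continuous_const.rpow (by fun_prop) fun θ => Or.inl (by norm_num))))
    convert this using 2
    rw [hG, AFBM.limitConst]
    ring
  have hvlim : Tendsto (fun n => N n * v n) atTop (𝓝 G) :=
    AFBM.tendsto_rpow_mul_integral_rpow hH hsmooth hmin hnondeg
      (g := fun θ => 8 * AFBM.spectralWeight H L ω θ) (continuous_const.mul hΛ)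
  -- The condition on `ω` keeps `cos(θs - ω)` away from zero. A positive limit makes `v n`
  -- eventually positive, as the deviation bound requires.
  have hGpos : 0 < G := by
    have hcos : Real.cos (θs - ω) ≠ 0 := fun h0 => by
      obtain ⟨k, hk⟩ := Real.cos_eq_zero_iff.1 h0
      refine hangle (-k - 1) ?_
      push_cast
      linarith
    have h1 := AFBM.spectralWeight_pos hH hL hcos
    have := Real.pi_pos
    rw [hG, AFBM.limitConst]
    positivity
  have hNnn : ∀ n, 0 ≤ N n := fun n => by simp only [hN]; positivity
  have hvpos : ∀ᶠ n in atTop, 0 < v n := by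
    filter_upwards [hvlim.eventually (lt_mem_nhds hGpos)] with n hn
    exact pos_of_mul_pos_right hn (hNnn n)
  obtain ⟨C, hC, hCsum⟩ := exists_sum_sum_one_div_le
  set K := 500 * √C with hK
  have hKpos : 0 < K := by positivity
  -- The threshold lies between the fluctuation scale `√n v n` and the scale `n v n` of the mean:
  -- deviations beyond it have summable probability, yet it vanishes after normalization.
  set t : ℕ → ℝ := fun n => (n : ℝ) ^ (3 / 4 : ℝ) * v n with ht
  have hmean : ∀ n : ℕ, 0 < n → ∑ k : Finset.Ico 1 n, ∫ x, D n k x * D n k x ∂P =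
      ((n : ℝ) - 1) * σ n := fun n hn => by
    simp only [hD, hA.integral_secondDiff_sq hH hc hL ε ω φ hn]
    rw [Finset.sum_const, nsmul_eq_mul]
    simp [Nat.cast_pred hn, hσ]
  have hquad : ∀ n x, ∑ k : Finset.Ico 1 n, D n k x ^ 2 =
      AFBM.quadVar (AFBM.radial A L ε ω) n x := fun n x =>
    Finset.sum_coe_sort (Finset.Ico 1 n) fun k => D n k x ^ 2
  have hbound : ∀ᶠ n : ℕ in atTop, P.real {x | t n ≤
      |AFBM.quadVar (AFBM.radial A L ε ω) n x - ((n : ℝ) - 1) * σ n|} ≤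
      2 * Real.exp (1 / 4) * Real.exp (-(1 / (4 * K)) * (n : ℝ) ^ (1 / 4 : ℝ)) := by
    filter_upwards [hvpos, eventually_gt_atTop 0] with n hvn hn
    have hn0 : (0 : ℝ) < n := by exact_mod_cast hn
    have hF : 0 < K * √n * v n := by positivity
    have hFX : ∑ k : Finset.Ico 1 n, ∑ l : Finset.Ico 1 n, (∫ x, D n k x * D n l x ∂P) ^ 2 ≤
        (K * √n * v n) ^ 2 := by
      calc _ ≤ ∑ k : Finset.Ico 1 n, ∑ l : Finset.Ico 1 n, (500 * v n) ^ 2 *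
            (1 / (1 + |(((k : ℕ) : ℤ) - ((l : ℕ) : ℤ) : ℤ)|) : ℝ) ^ 2 := by
            refine Finset.sum_le_sum fun k _ => Finset.sum_le_sum fun l _ => ?_
            have := hA.abs_integral_secondDiff_mul_le hH hc hL ε ω φ hn k l
            rw [← sq_abs, ← mul_pow]
            refine pow_le_pow_left₀ (abs_nonneg _) (this.trans (le_of_eq ?_)) 2
            push_cast
            ring
        _ = (500 * v n) ^ 2 * ∑ k : Finset.Ico 1 n, ∑ l : Finset.Ico 1 n,
            (1 / (1 + |(((k : ℕ) : ℤ) - ((l : ℕ) : ℤ) : ℤ)|) : ℝ) ^ 2 := by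
            simp only [Finset.mul_sum]
        _ ≤ (500 * v n) ^ 2 * (C * n) := by gcongr; exact hCsum n
        _ = _ := by
            rw [hK, mul_pow, mul_pow, mul_pow, mul_pow, Real.sq_sqrt hC.le, Real.sq_sqrt hn0.le]
            ring
    have := measure_abs_sum_sq_sub_integral_ge_le (X := fun (k : Finset.Ico 1 n) => D n k)
      (hA.hasGaussianLaw_secondDiff L ε ω n) (fun k => hA.integral_secondDiff L ε ω n k) hF hFX
      (t n)
    simp only [hquad, hmean n hn] at this
    refine this.trans (le_of_eq ?_)
    rw [mul_assoc (2 : ℝ) (Real.exp _), ← Real.exp_add]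
    congr 2
    have e : (n : ℝ) ^ (3 / 4 : ℝ) = (n : ℝ) ^ (1 / 4 : ℝ) * √n := by
      rw [Real.sqrt_eq_rpow, ← Real.rpow_add hn0]; norm_num
    simp only [ht]
    rw [e]
    field_simp
    ring
  have hsum : ∑' n : ℕ, P {x | t n ≤
      |AFBM.quadVar (AFBM.radial A L ε ω) n x - ((n : ℝ) - 1) * σ n|} ≠ ∞ := by
    have hs : Summable fun n : ℕ => P.real {x | t n ≤
        |AFBM.quadVar (AFBM.radial A L ε ω) n x - ((n : ℝ) - 1) * σ n|} := by
      refine Summable.of_norm_bounded_eventually_nat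
        ((summable_exp_neg_mul_rpow (c := 1 / (4 * K)) (s := 1 / 4) (by positivity)
          (by norm_num)).mul_left (2 * Real.exp (1 / 4))) ?_
      filter_upwards [hbound] with n hn
      rwa [Real.norm_of_nonneg measureReal_nonneg]
    have := hs.tsum_ofReal_ne_top
    simpa only [measureReal_def, ENNReal.ofReal_toReal (measure_ne_top P _)] using this
  filter_upwards [ae_eventually_notMem hsum] with x hx
  have hinv : Tendsto (fun n : ℕ => ((n : ℝ) - 1) / n) atTop (𝓝 1) := by
    have := (tendsto_const_nhds (x := (1 : ℝ))).sub tendsto_one_div_atTop_nhds_zero_nat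
    rw [sub_zero] at this
    refine this.congr' ?_
    filter_upwards [eventually_gt_atTop 0] with n hn
    have hn0 : (n : ℝ) ≠ 0 := by exact_mod_cast hn.ne'
    field_simp
  have hmain : Tendsto (fun n : ℕ => ((n : ℝ) - 1) / n * (N n * σ n)) atTop
      (𝓝 ((4 - 2 ^ (2 * h)) * G)) := by simpa using hinv.mul hσlim
  have hsmall : Tendsto (fun n : ℕ => (n : ℝ) ^ (-(1 / 4) : ℝ) * (N n * v n)) atTop (𝓝 0) := by
    have := ((tendsto_rpow_neg_atTop (y := 1 / 4) (by norm_num)).comp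
      tendsto_natCast_atTop_atTop).mul hvlim
    simpa using this
  -- Outside finitely many `n` the error is at most `N n / n * t n = n^(-1/4) (N n * v n)`, a null
  -- sequence times a convergent one.
  have herr : Tendsto (fun n : ℕ => N n / n *
      (AFBM.quadVar (AFBM.radial A L ε ω) n x - ((n : ℝ) - 1) * σ n)) atTop (𝓝 0) := by
    refine squeeze_zero_norm' ?_ hsmall
    filter_upwards [hx, eventually_gt_atTop 0] with n hn hn'
    have hn0 : (0 : ℝ) < n := by exact_mod_cast hn'
    have hn1 : |AFBM.quadVar (AFBM.radial A L ε ω) n x - ((n : ℝ) - 1) * σ n| ≤ t n :=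
      (not_le.1 hn).le
    have hNn := hNnn n
    rw [norm_mul, Real.norm_eq_abs, Real.norm_eq_abs, abs_of_nonneg (by positivity : 0 ≤ N n / n)]
    refine (mul_le_mul_of_nonneg_left hn1 (by positivity)).trans (le_of_eq ?_)
    have e : (n : ℝ) ^ (-(1 / 4) : ℝ) = (n : ℝ) ^ (3 / 4 : ℝ) / n := by
      rw [← Real.rpow_sub_one hn0.ne']; norm_num
    rw [e, ht]
    ring
  have := hmain.add herr
  rw [add_zero] at this
  refine this.congr' ?_
  filter_upwards [eventually_gt_atTop 0] with n hn
  have hn0 : (0 : ℝ) < n := by exact_mod_cast hn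
  rw [Real.rpow_sub_one hn0.ne']
  simp only [hN]
  ring
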